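/- Theorem. There is a deterministic algorithm $A$ and a polynomial $P$ such that the following holds for every prime $p$. Let the field $\mathbf{F}_{p^p}$ be given as $\mathbf{F}_p[y]/(u(y))$ with $u\in\mathbf{F}_p[y]$ irreducible of degree $p$ (for instance $u=y^p-y-a$ with $a\in\mathbf{F}_p^*$), its elements being represented by polynomials over $\mathbf{F}_p$ of degree less than $p$. Let $g=\alpha+b$, where $\mathbf{F}_p(\alpha)=\mathbf{F}_{p^p}$, $\alpha^p-\alpha\in\mathbf{F}_p^*$ and $b\in\mathbf{F}_p$ ($b=0$ is allowed). Let $e$ be an integer with $0\le e<p^p$ and $S_p(e)\le p-1$, where $S_p(e)$ denotes the sum of the digits of $e$ in base $p$. Then: 1. given $p$, $u$, $g$ and $g^e$, the algorithm $A$ outputs $e$ in time (number of bit operations, measured as the logarithmic cost on a random access machine) at most $P(\log(p^p))$; 2. there is no integer $e'\ne e$ with $0\le e'<p^p$, $S_p(e')\le p-1$ and $g^{e'}=g^e$. -/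

import Mathlib

open scoped Polynomial IntermediateField

namespace RAM

/-- Memory of a random access machine: cells indexed by `ℕ`, each holding a natural number. -/
abbrev Mem := ℕ → ℕ

/-- Arithmetic expressions. `mem a` is the content of the cell whose address is the value of `a`
(so `mem (const i)` is a direct access and `mem (mem (const i))` an indirect one). -/
inductive Expr where
  | const (n : ℕ)
  | mem (a : Expr)
  | add (x y : Expr)
  | sub (x y : Expr)
  | mul (x y : Expr)
  | div (x y : Expr)
  | mod (x y : Expr)

/-- Value of an expression. Subtraction is truncated at `0`, division is Euclidean division (with
`x / 0 = 0` and `x % 0 = x`). -/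
def Expr.eval (M : Mem) : Expr → ℕ
  | .const n => n
  | .mem a => M (a.eval M)
  | .add x y => x.eval M + y.eval M
  | .sub x y => x.eval M - y.eval M
  | .mul x y => x.eval M * y.eval M
  | .div x y => x.eval M / y.eval M
  | .mod x y => x.eval M % y.eval M

/-- Number of bit operations charged for handling the number `n`: its binary length, plus one. -/
def len (n : ℕ) : ℕ := Nat.size n + 1

/-- Bit cost (logarithmic cost) of evaluating an expression. A memory access is charged the lengths
of the address and of the content; an arithmetic operation is charged the product of the
lengths of its operands (schoolbook arithmetic). -/
def Expr.cost (M : Mem) : Expr → ℕ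
  | .const n => len n
  | .mem a => a.cost M + len (a.eval M) + len (M (a.eval M))
  | .add x y => x.cost M + y.cost M + len (x.eval M) * len (y.eval M)
  | .sub x y => x.cost M + y.cost M + len (x.eval M) * len (y.eval M)
  | .mul x y => x.cost M + y.cost M + len (x.eval M) * len (y.eval M)
  | .div x y => x.cost M + y.cost M + len (x.eval M) * len (y.eval M)
  | .mod x y => x.cost M + y.cost M + len (x.eval M) * len (y.eval M)

/-- Deterministic programs. `assign a v` writes the value of `v` into the cell whose address is
the value of `a`; a condition counts as true when its value is nonzero. -/
inductive Prog where
  | skip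
  | assign (a v : Expr)
  | seq (A B : Prog)
  | ite (c : Expr) (A B : Prog)
  | loop (c : Expr) (A : Prog)

/-- `Exec A M M' t`: started with memory `M`, the program `A` halts with memory `M'`, and
the total bit cost of the run is `t`. -/
inductive Exec : Prog → Mem → Mem → ℕ → Prop where
  | skip (M : Mem) : Exec .skip M M 1
  | assign (a v : Expr) (M : Mem) :
      Exec (.assign a v) M (Function.update M (a.eval M) (v.eval M))
        (a.cost M + v.cost M + len (a.eval M) + len (v.eval M))
  | seq {A B : Prog} {M M' M'' : Mem} {t t' : ℕ} :
      Exec A M M' t → Exec B M' M'' t' → Exec (.seq A B) M M'' (t + t')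
  | ite_true {c : Expr} {A B : Prog} {M M' : Mem} {t : ℕ} :
      c.eval M ≠ 0 → Exec A M M' t → Exec (.ite c A B) M M' (c.cost M + t)
  | ite_false {c : Expr} {A B : Prog} {M M' : Mem} {t : ℕ} :
      c.eval M = 0 → Exec B M M' t → Exec (.ite c A B) M M' (c.cost M + t)
  | loop_exit {c : Expr} {A : Prog} {M : Mem} :
      c.eval M = 0 → Exec (.loop c A) M M (c.cost M)
  | loop_step {c : Expr} {A : Prog} {M M' M'' : Mem} {t t' : ℕ} :
      c.eval M ≠ 0 → Exec A M M' t → Exec (.loop c A) M' M'' t' →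
        Exec (.loop c A) M M'' (c.cost M + t + t')

/-- Initial memory: the input list fills the cells `0, 1, 2, …`, all other cells hold `0`. -/
def init (l : List ℕ) : Mem := fun i => l.getD i 0

/-- On input `l`, the program `A` halts with bit cost at most `T` and leaves `n` in cell `0`. -/
def OutputsWithin (A : Prog) (l : List ℕ) (n : ℕ) (T : ℝ) : Prop :=
  ∃ (M : Mem) (t : ℕ), Exec A (init l) M t ∧ M 0 = n ∧ (t : ℝ) ≤ T

end RAM

/-- The first `k` coefficients of a polynomial over `𝔽_p`, lowest degree first, each written as
its representative in `{0, …, p - 1}`. -/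
def coeffVals (p k : ℕ) (v : (ZMod p)[X]) : List ℕ :=
  (List.range k).map fun i => (v.coeff i).val

/-- Input of the discrete logarithm problem in `𝔽_p[y]/(u)` with `deg u = p`: the prime `p`, the
`p + 1` coefficients of `u`, and the `p` coordinates of the base and of the target, which are the
residue classes of the polynomials `v` and `w` of degree less than `p`. -/
def dlogInput (p : ℕ) (u v w : (ZMod p)[X]) : List ℕ :=
  p :: (coeffVals p (p + 1) u ++ coeffVals p p v ++ coeffVals p p w)

/-- The sum of the digits of `e` in base `p`. -/
def digitSum (p e : ℕ) : ℕ := (Nat.digits p e).sum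

/-! Since `α ^ p - α = a`, also `g ^ p = g + a`, so the `p ^ k`-th power of `g` is `g + k a`. If `e`
has base-`p` digits `d k`, then `g ^ e` is the product of the `(g + k a) ^ d k`, the value at `g` of
a polynomial of degree `S_p(e) < p` that splits into the pairwise distinct linear factors `X + k a`.
The multiplicities of the factors are the digits.

No factorization is needed to read them off. For `P` of degree less than `p`, power sums over `𝔽_p`
show that `P(g)` summed over its `p` Frobenius powers is minus the coefficient of `X ^ (p - 1)`
(`frobSum_aeval`). Let `h` satisfy `h * (g + k a) = a`. If `X + k a` divides `P`, then `P(g) * h`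
comes from a polynomial of degree below `p - 1` and the sum vanishes. Otherwise it comes from a
polynomial of degree less than `p` whose coefficient at `X ^ (p - 1)` is `P(-k a) ≠ 0`
(`frobSum_mul_ne_zero`). Hence one trace decides divisibility, and `p` trials for each of the `p`
conjugates strip off all factors (`trialStep_iterate`, `digitStep_iterate`). The next divisor is `h
^ p`.

Field elements are handled by Kronecker substitution: a polynomial in the root of `u` is stored as
its value at a large base `B`, and reduction modulo `u` becomes one integer remainder
(`Enc.mul_mod`), followed by reduction of the digits modulo `p` (`Enc.normalize`).

For the running time, the program is written in a small language whose loops run at most `p` times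
and whose assignments enlarge numbers at most by the factor `p ^ 3`. The number of steps and the
length of all numbers are then polynomial in `p` (`Cmd.runs_toProg`, `Cmd.exists_outputsWithin`),
and `p` is at most `2 log (p ^ p)`.

Uniqueness of `e` comes for free: the result of the program depends only on the input, and it equals
every admissible exponent. -/

namespace RAM

/-! ### Cost of expressions in a bounded memory -/

/-- Exponent `d` such that the value of the expression is at most `(N + 2) ^ d` when all memory
cells hold numbers at most `N`. -/
def Expr.deg : Expr → ℕ
  | .const n => n + 1
  | .mem _ => 1
  | .add x y => x.deg + y.deg + 1
  | .sub x _ => x.deg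
  | .mul x y => x.deg + y.deg
  | .div x _ => x.deg
  | .mod x _ => x.deg

/-- Constant `C` such that the cost of the expression is at most `C * (Nat.size (N + 2)) ^ 2` when
all memory cells hold numbers at most `N`. -/
def Expr.weight : Expr → ℕ
  | .const n => n + 2
  | .mem a => a.weight + (a.deg + 1) + 2
  | .add x y => x.weight + y.weight + (x.deg + 1) * (y.deg + 1)
  | .sub x y => x.weight + y.weight + (x.deg + 1) * (y.deg + 1)
  | .mul x y => x.weight + y.weight + (x.deg + 1) * (y.deg + 1)
  | .div x y => x.weight + y.weight + (x.deg + 1) * (y.deg + 1)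
  | .mod x y => x.weight + y.weight + (x.deg + 1) * (y.deg + 1)

theorem Expr.deg_pos (e : Expr) : 1 ≤ e.deg := by
  induction e <;> simp only [Expr.deg] <;> omega

/-- The base `N + 2` is at least `2`, so powers of it absorb constants, and one extra factor pays
for a sum of two terms. -/
theorem Expr.eval_le {M : Mem} {N : ℕ} (hM : ∀ i, M i ≤ N) (e : Expr) :
    e.eval M ≤ (N + 2) ^ e.deg := by
  have h2 : 1 ≤ N + 2 := by omega
  induction e with
  | const n =>
    calc n ≤ 2 ^ (n + 1) := (Nat.lt_two_pow_self.le).trans (Nat.pow_le_pow_right (by simp) (by simp))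
      _ ≤ (N + 2) ^ (n + 1) := Nat.pow_le_pow_left (by omega) _
  | mem a _ => simpa [Expr.eval, Expr.deg] using (hM _).trans (by omega)
  | add x y hx hy =>
    have h3 : (N + 2) ^ x.deg ≤ (N + 2) ^ (x.deg + y.deg) := Nat.pow_le_pow_right h2 (by omega)
    have h4 : (N + 2) ^ y.deg ≤ (N + 2) ^ (x.deg + y.deg) := Nat.pow_le_pow_right h2 (by omega)
    simp only [Expr.eval, Expr.deg, pow_succ]
    nlinarith [Nat.zero_le (N * (N + 2) ^ (x.deg + y.deg))]
  | sub x y hx hy => exact (Nat.sub_le _ _).trans hx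
  | mul x y hx hy => simpa only [Expr.eval, Expr.deg, pow_add] using Nat.mul_le_mul hx hy
  | div x y hx hy => exact (Nat.div_le_self _ _).trans hx
  | mod x y hx hy => exact (Nat.mod_le _ _).trans hx

theorem one_le_size (N : ℕ) : 1 ≤ Nat.size (N + 2) := Nat.size_pos.2 (by omega)

theorem size_pow_le {x d n : ℕ} (hd : 1 ≤ d) (h : n ≤ x ^ d) : Nat.size n ≤ d * Nat.size x := by
  refine Nat.size_le.2 (h.trans_lt ?_)
  rw [mul_comm, pow_mul]
  exact Nat.pow_lt_pow_left (Nat.lt_size_self x) (by omega)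

theorem Expr.len_eval_le {M : Mem} {N : ℕ} (hM : ∀ i, M i ≤ N) (e : Expr) :
    len (e.eval M) ≤ (e.deg + 1) * Nat.size (N + 2) := by
  have h1 := size_pow_le e.deg_pos (e.eval_le hM)
  have h2 := one_le_size N
  unfold len
  nlinarith

theorem Expr.cost_le {M : Mem} {N : ℕ} (hM : ∀ i, M i ≤ N) (e : Expr) :
    e.cost M ≤ e.weight * Nat.size (N + 2) ^ 2 := by
  have h1 := one_le_size N
  have h2 : Nat.size (N + 2) ≤ Nat.size (N + 2) ^ 2 := Nat.le_self_pow (by simp) _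
  have bin : ∀ x y : Expr, x.cost M ≤ x.weight * Nat.size (N + 2) ^ 2 →
      y.cost M ≤ y.weight * Nat.size (N + 2) ^ 2 →
      x.cost M + y.cost M + len (x.eval M) * len (y.eval M) ≤
        (x.weight + y.weight + (x.deg + 1) * (y.deg + 1)) * Nat.size (N + 2) ^ 2 := by
    intro x y hx hy
    have := Nat.mul_le_mul (x.len_eval_le hM) (y.len_eval_le hM)
    calc _ ≤ _ := Nat.add_le_add (Nat.add_le_add hx hy) this
      _ = _ := by ring
  induction e with
  | const n =>
    have := (Expr.const n).len_eval_le hM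
    exact this.trans (Nat.mul_le_mul_left _ h2)
  | mem a ha =>
    have h3 := (a.len_eval_le hM).trans (Nat.mul_le_mul_left _ h2)
    have h4 := ((Expr.mem a).len_eval_le hM).trans (Nat.mul_le_mul_left _ h2)
    simp only [Expr.cost, Expr.weight, Expr.eval, Expr.deg] at *
    nlinarith
  | add x y hx hy => exact bin x y hx hy
  | sub x y hx hy => exact bin x y hx hy
  | mul x y hx hy => exact bin x y hx hy
  | div x y hx hy => exact bin x y hx hy
  | mod x y hx hy => exact bin x y hx hy

/-- Constant for the cost of an assignment in a bounded memory. -/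
def assignWeight (a v : Expr) : ℕ := a.weight + v.weight + (a.deg + 1) + (v.deg + 1)

theorem assign_cost_le {M : Mem} {N : ℕ} (hM : ∀ i, M i ≤ N) (a v : Expr) :
    a.cost M + v.cost M + len (a.eval M) + len (v.eval M) ≤
      assignWeight a v * Nat.size (N + 2) ^ 2 := by
  have h2 : Nat.size (N + 2) ≤ Nat.size (N + 2) ^ 2 := Nat.le_self_pow (by simp) _
  have h3 := (a.len_eval_le hM).trans (Nat.mul_le_mul_left _ h2)
  have h4 := (v.len_eval_le hM).trans (Nat.mul_le_mul_left _ h2)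
  have h5 := a.cost_le hM
  have h6 := v.cost_le hM
  unfold assignWeight
  nlinarith

/-! ### A register language with bounded loops -/

/-- Terms over registers, with read access to the input. -/
inductive Term where
  | const (n : ℕ)
  | var (k : ℕ)
  | inp (a : Term)
  | add (x y : Term)
  | sub (x y : Term)
  | mul (x y : Term)
  | div (x y : Term)
  | mod (x y : Term)

/-- Value of a term for the input `I` and the register contents `σ`. -/
def Term.val (I σ : Mem) : Term → ℕ
  | .const n => n
  | .var k => σ k
  | .inp a => I (a.val I σ % (3 * I 0 + 2))
  | .add x y => x.val I σ + y.val I σ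
  | .sub x y => x.val I σ - y.val I σ
  | .mul x y => x.val I σ * y.val I σ
  | .div x y => x.val I σ / y.val I σ
  | .mod x y => x.val I σ % y.val I σ

/-- Commands: `ifz c A` runs `A` when `c` is zero, and `rep m A` runs `A` exactly `I 0 - m` times,
where `I` is the input. -/
inductive Cmd where
  | set (k : ℕ) (e : Term)
  | seq (A B : Cmd)
  | ifz (c : Term) (A : Cmd)
  | rep (m : ℕ) (A : Cmd)

/-- Effect of a command on the registers. -/
def Cmd.run (I : Mem) : Cmd → Mem → Mem
  | .set k e => fun σ => Function.update σ k (e.val I σ)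
  | .seq A B => fun σ => B.run I (A.run I σ)
  | .ifz c A => fun σ => if c.val I σ = 0 then A.run I σ else σ
  | .rep m A => (A.run I)^[I 0 - m]

/-- The registers that a command may change. -/
def Cmd.writes : Cmd → List ℕ
  | .set k _ => [k]
  | .seq A B => A.writes ++ B.writes
  | .ifz _ A => A.writes
  | .rep _ A => A.writes

/-- Frame rule: loop invariants carry over registers that a subroutine does not touch. -/
theorem Cmd.run_of_notMem (I : Mem) (A : Cmd) {k : ℕ} (σ : Mem) (hk : k ∉ A.writes) :
    A.run I σ k = σ k := by
  induction A generalizing σ with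
  | set j e => simp [Cmd.run, Cmd.writes] at *; simp [Function.update_of_ne hk]
  | seq A B hA hB =>
    simp only [Cmd.writes, List.mem_append, not_or] at hk
    simp [Cmd.run, hB _ hk.2, hA _ hk.1]
  | ifz c A hA =>
    simp only [Cmd.run]
    split_ifs
    · exact hA _ hk
    · rfl
  | rep m A hA =>
    have : ∀ n σ, ((A.run I)^[n] σ) k = σ k := by
      intro n
      induction n with
      | zero => simp
      | succ n ih => intro σ; rw [Function.iterate_succ_apply', hA _ hk, ih]
    exact this _ σ

/-! ### Compilation to the random access machine -/

/-- Address of the first cell after an input of length `3 * p + 2`, where cell `0` holds `p`. -/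
def base : Expr := .add (.mul (.const 3) (.mem (.const 0))) (.const 2)

/-- Address of the `k`-th register. -/
def varAddr (k : ℕ) : Expr := .add base (.const (2 * k))

/-- Address of the loop counter used at nesting depth `d`. -/
def ctrAddr (d : ℕ) : Expr := .add base (.const (2 * d + 1))

/-- The remainder modulo `base` keeps every input read inside the input block, away from registers
and counters. -/
def Term.toExpr : Term → Expr
  | .const n => .const n
  | .var k => .mem (varAddr k)
  | .inp a => .mem (.mod a.toExpr base)
  | .add x y => .add x.toExpr y.toExpr
  | .sub x y => .sub x.toExpr y.toExpr
  | .mul x y => .mul x.toExpr y.toExpr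
  | .div x y => .div x.toExpr y.toExpr
  | .mod x y => .mod x.toExpr y.toExpr

/-- The first argument is the nesting depth, so that nested loops use different counters. In the
conditional, `skip` comes first because a nonzero condition counts as true. -/
def Cmd.toProg : ℕ → Cmd → Prog
  | _, .set k e => .assign (varAddr k) e.toExpr
  | d, .seq A B => .seq (A.toProg d) (B.toProg d)
  | d, .ifz c A => .ite c.toExpr .skip (A.toProg d)
  | d, .rep m A => .seq (.assign (ctrAddr d) (.sub (.mem (.const 0)) (.const m)))
      (.loop (.mem (ctrAddr d))
        (.seq (A.toProg (d + 1)) (.assign (ctrAddr d) (.sub (.mem (ctrAddr d)) (.const 1)))))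

/-- Memory holding the input `I`, and after it the registers `σ` and the loop counters `κ`. -/
def layout (I σ κ : Mem) : Mem := fun i =>
  if i < 3 * I 0 + 2 then I i
  else if (i - (3 * I 0 + 2)) % 2 = 0 then σ ((i - (3 * I 0 + 2)) / 2)
  else κ ((i - (3 * I 0 + 2)) / 2)

/-! ### Reading and writing a memory split into input, registers and counters. -/

section layout

variable (I σ κ : Mem)

theorem layout_input {i : ℕ} (h : i < 3 * I 0 + 2) : layout I σ κ i = I i := by
  simp [layout, h]

theorem layout_var (k : ℕ) : layout I σ κ (3 * I 0 + 2 + 2 * k) = σ k := by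
  simp [layout]

theorem layout_ctr (d : ℕ) : layout I σ κ (3 * I 0 + 2 + (2 * d + 1)) = κ d := by
  have h1 : (2 * d + 1) % 2 = 1 := by omega
  have h2 : (2 * d + 1) / 2 = d := by omega
  simp [layout, h2]

theorem update_layout_var (k v : ℕ) :
    Function.update (layout I σ κ) (3 * I 0 + 2 + 2 * k) v =
      layout I (Function.update σ k v) κ := by
  funext i
  by_cases hi : i = 3 * I 0 + 2 + 2 * k
  · subst hi; rw [Function.update_self, layout_var, Function.update_self]
  · rw [Function.update_of_ne hi]
    unfold layout
    split_ifs with h1 h2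
    · rfl
    · rw [Function.update_of_ne]; omega
    · rfl

theorem update_layout_ctr (d v : ℕ) :
    Function.update (layout I σ κ) (3 * I 0 + 2 + (2 * d + 1)) v =
      layout I σ (Function.update κ d v) := by
  funext i
  by_cases hi : i = 3 * I 0 + 2 + (2 * d + 1)
  · subst hi; rw [Function.update_self, layout_ctr, Function.update_self]
  · rw [Function.update_of_ne hi]
    unfold layout
    split_ifs with h1 h2
    · rfl
    · rfl
    · rw [Function.update_of_ne]; omega

theorem eval_base : base.eval (layout I σ κ) = 3 * I 0 + 2 := by
  simp [base, Expr.eval, layout_input]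

theorem eval_varAddr (k : ℕ) : (varAddr k).eval (layout I σ κ) = 3 * I 0 + 2 + 2 * k := by
  simp [varAddr, Expr.eval, eval_base]

theorem eval_ctrAddr (d : ℕ) : (ctrAddr d).eval (layout I σ κ) = 3 * I 0 + 2 + (2 * d + 1) := by
  simp [ctrAddr, Expr.eval, eval_base]

theorem eval_ctr (d : ℕ) : (Expr.mem (ctrAddr d)).eval (layout I σ κ) = κ d := by
  simp only [Expr.eval, eval_ctrAddr, layout_ctr]

theorem eval_toExpr (e : Term) : e.toExpr.eval (layout I σ κ) = e.val I σ := by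
  induction e with
  | const n => rfl
  | var k => simp only [Term.toExpr, Expr.eval, eval_varAddr, layout_var, Term.val]
  | inp a ih =>
    simp only [Term.toExpr, Expr.eval, eval_base, ih, Term.val]
    exact layout_input _ _ _ (Nat.mod_lt _ (by omega))
  | _ => simp_all [Term.toExpr, Expr.eval, Term.val]

variable {I σ κ}

theorem layout_le {N : ℕ} (hI : ∀ i, I i ≤ N) (hσ : ∀ i, σ i ≤ N) (hκ : ∀ i, κ i ≤ N) (i : ℕ) :
    layout I σ κ i ≤ N := by
  unfold layout
  split_ifs
  · exact hI _
  · exact hσ _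
  · exact hκ _

end layout

/-! ### Cost of compiled commands -/

/-- Every assignment enlarges the largest number in memory at most by the factor `I 0 ^ 3`. -/
def Cmd.Tame (I : Mem) : Cmd → Prop
  | .set _ e => ∀ (σ : Mem) (N : ℕ), I 0 ≤ N → (∀ i, σ i ≤ N) → e.val I σ ≤ N * I 0 ^ 3
  | .seq A B => A.Tame I ∧ B.Tame I
  | .ifz _ A => A.Tame I
  | .rep _ A => A.Tame I

/-- Number of steps of a command when loops run `p` times. -/
def Cmd.steps (p : ℕ) : Cmd → ℕ
  | .set _ _ => 1
  | .seq A B => A.steps p + B.steps p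
  | .ifz _ A => A.steps p + 1
  | .rep _ A => p * (A.steps p + 1) + 1

/-- Constant for the cost of a single step of a compiled command. -/
def Cmd.weight : ℕ → Cmd → ℕ
  | _, .set k e => assignWeight (varAddr k) e.toExpr
  | d, .seq A B => A.weight d + B.weight d
  | d, .ifz c A => c.toExpr.weight + 1 + A.weight d
  | d, .rep m A => A.weight (d + 1) +
      assignWeight (ctrAddr d) (.sub (.mem (.const 0)) (.const m)) +
      assignWeight (ctrAddr d) (.sub (.mem (ctrAddr d)) (.const 1)) +
      (Expr.mem (ctrAddr d)).weight

/-- `Runs I X d σ σ' κ N s C`: with registers `σ` and counters `κ`, and changing only counters of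
index at least `d`, the program `X` leads to registers `σ'`; registers and counters are then at
most `N * I 0 ^ (3 * s)`, and the cost is at most `C * s` times the square of the length of that
number. -/
def Runs (I : Mem) (X : Prog) (d : ℕ) (σ σ' κ : Mem) (N s C : ℕ) : Prop :=
  ∃ (κ' : Mem) (t : ℕ), Exec X (layout I σ κ) (layout I σ' κ') t ∧ (∀ i < d, κ' i = κ i) ∧
    (∀ i, κ' i ≤ N * I 0 ^ (3 * s)) ∧ (∀ i, σ' i ≤ N * I 0 ^ (3 * s)) ∧
    t ≤ C * s * Nat.size (N * I 0 ^ (3 * s) + 2) ^ 2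

theorem sq_size_mono {m n : ℕ} (h : m ≤ n) : Nat.size (m + 2) ^ 2 ≤ Nat.size (n + 2) ^ 2 :=
  Nat.pow_le_pow_left (Nat.size_le_size (by omega)) 2

theorem one_le_sq_size (N : ℕ) : 1 ≤ Nat.size (N + 2) ^ 2 := Nat.one_le_pow _ _ (one_le_size N)

theorem le_mul_pow {p : ℕ} (hp : 1 ≤ p) (N s : ℕ) : N ≤ N * p ^ s :=
  Nat.le_mul_of_pos_right _ (Nat.pow_pos hp)

theorem mul_pow_mono {p : ℕ} (hp : 1 ≤ p) (N : ℕ) {s s' : ℕ} (h : s ≤ s') :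
    N * p ^ (3 * s) ≤ N * p ^ (3 * s') :=
  Nat.mul_le_mul_left _ (Nat.pow_le_pow_right hp (by omega))

theorem mul_pow_split (p N s s' : ℕ) :
    N * p ^ (3 * s) * p ^ (3 * s') = N * p ^ (3 * (s + s')) := by
  rw [mul_assoc, ← pow_add]; ring_nf

theorem Runs.mono {I : Mem} (h0 : 1 ≤ I 0) {X : Prog} {d : ℕ} {σ σ' κ : Mem} {N s s' C C' : ℕ}
    (h : Runs I X d σ σ' κ N s C) (hs : s ≤ s') (hC : C ≤ C') : Runs I X d σ σ' κ N s' C' := by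
  obtain ⟨κ', t, hE, hd, hκ, hσ, ht⟩ := h
  exact ⟨κ', t, hE, hd, fun i => (hκ i).trans (mul_pow_mono h0 N hs),
    fun i => (hσ i).trans (mul_pow_mono h0 N hs),
    ht.trans (Nat.mul_le_mul (Nat.mul_le_mul hC hs) (sq_size_mono (mul_pow_mono h0 N hs)))⟩

/-- The final size bound of the first program is the initial bound of the second. The growth factors
multiply, so the exponents, and with them the step counts, add up. -/
theorem Runs.seq {I : Mem} (h0 : 1 ≤ I 0) {X Y : Prog} {d : ℕ} {σ σ' σ'' κ : Mem}
    {N s s' C : ℕ} (hX : Runs I X d σ σ' κ N s C)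
    (hY : ∀ κ' : Mem, (∀ i, κ' i ≤ N * I 0 ^ (3 * s)) → (∀ i, σ' i ≤ N * I 0 ^ (3 * s)) →
      Runs I Y d σ' σ'' κ' (N * I 0 ^ (3 * s)) s' C) :
    Runs I (.seq X Y) d σ σ'' κ N (s + s') C := by
  obtain ⟨κ₁, t₁, hE₁, hd₁, hκ₁, hσ₁, ht₁⟩ := hX
  obtain ⟨κ₂, t₂, hE₂, hd₂, hκ₂, hσ₂, ht₂⟩ := hY κ₁ hκ₁ hσ₁
  rw [mul_pow_split] at hκ₂ hσ₂ ht₂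
  refine ⟨κ₂, t₁ + t₂, .seq hE₁ hE₂, fun i hi => (hd₂ i hi).trans (hd₁ i hi), hκ₂, hσ₂, ?_⟩
  have := ht₁.trans (Nat.mul_le_mul_left (C * s)
    (sq_size_mono (mul_pow_mono h0 N (Nat.le_add_right s s'))))
  calc t₁ + t₂ ≤ _ := Nat.add_le_add this ht₂
    _ = _ := by ring

theorem exec_assign_ctr {I σ κ : Mem} {N : ℕ} (hI : ∀ i, I i ≤ N) (hσ : ∀ i, σ i ≤ N)
    (hκ : ∀ i, κ i ≤ N) (d : ℕ) (e : Expr) :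
    ∃ t, Exec (.assign (ctrAddr d) e) (layout I σ κ)
        (layout I σ (Function.update κ d (e.eval (layout I σ κ)))) t ∧
      t ≤ assignWeight (ctrAddr d) e * Nat.size (N + 2) ^ 2 := by
  have h := Exec.assign (ctrAddr d) e (layout I σ κ)
  rw [eval_ctrAddr, update_layout_ctr] at h
  have h' := assign_cost_le (layout_le hI hσ hκ) (ctrAddr d) e
  rw [eval_ctrAddr] at h'
  exact ⟨_, h, h'⟩

/-- The body preserves counters of index at most `d`, so the loop counter survives it. Each round
counts `s + 1` steps, one more than the body to cover test and decrement; the last `+ 1` is the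
failing test. -/
theorem Runs.loop {I : Mem} (hI : ∀ i, I i ≤ I 0) (h0 : 1 ≤ I 0) {X : Prog} {d s C : ℕ}
    {f : Mem → Mem}
    (hX : ∀ (σ κ : Mem) (N : ℕ), I 0 ≤ N → (∀ i, σ i ≤ N) → (∀ i, κ i ≤ N) →
      Runs I X (d + 1) σ (f σ) κ N s C)
    (n : ℕ) (σ κ : Mem) (N : ℕ) (hN : I 0 ≤ N) (hσ : ∀ i, σ i ≤ N) (hκ : ∀ i, κ i ≤ N)
    (hn : κ d = n) :
    Runs I (.loop (.mem (ctrAddr d))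
        (.seq X (.assign (ctrAddr d) (.sub (.mem (ctrAddr d)) (.const 1))))) d σ (f^[n] σ) κ N
      (n * (s + 1) + 1)
      (C + assignWeight (ctrAddr d) (.sub (.mem (ctrAddr d)) (.const 1)) +
        (Expr.mem (ctrAddr d)).weight) := by
  generalize hw : assignWeight (ctrAddr d) (.sub (.mem (ctrAddr d)) (.const 1)) = w
  generalize hc : (Expr.mem (ctrAddr d)).weight = c
  induction n generalizing σ κ N with
  | zero =>
    have hcost := (Expr.mem (ctrAddr d)).cost_le (layout_le (fun i => (hI i).trans hN) hσ hκ)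
    refine ⟨κ, _, .loop_exit (by rw [eval_ctr, hn]), fun _ _ => rfl,
      fun i => (hκ i).trans (le_mul_pow h0 _ _), fun i => (hσ i).trans (le_mul_pow h0 _ _),
      hcost.trans ?_⟩
    rw [hc]
    exact Nat.mul_le_mul (by simp) (sq_size_mono (le_mul_pow h0 _ _))
  | succ n ih =>
    have hcost := (Expr.mem (ctrAddr d)).cost_le (layout_le (fun i => (hI i).trans hN) hσ hκ)
    obtain ⟨κ₁, t₁, hE₁, hd₁, hκ₁, hσ₁, ht₁⟩ := hX σ κ N hN hσ hκ
    have hN₁ : N ≤ N * I 0 ^ (3 * s) := le_mul_pow h0 _ _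
    obtain ⟨t₂, hE₂, ht₂⟩ := exec_assign_ctr (fun i => (hI i).trans (hN.trans hN₁)) hσ₁ hκ₁ d
      (.sub (.mem (ctrAddr d)) (.const 1))
    have hval : (Expr.sub (.mem (ctrAddr d)) (.const 1)).eval (layout I (f σ) κ₁) = n := by
      rw [Expr.eval, eval_ctr, hd₁ d (by omega), hn]; rfl
    rw [hval] at hE₂
    have hN₂ : N * I 0 ^ (3 * s) ≤ N * I 0 ^ (3 * (s + 1)) := mul_pow_mono h0 _ (by omega)
    obtain ⟨κ₃, t₃, hE₃, hd₃, hκ₃, hσ₃, ht₃⟩ := ih (f σ) (Function.update κ₁ d n)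
      (N * I 0 ^ (3 * (s + 1))) (hN.trans (hN₁.trans hN₂)) (fun i => (hσ₁ i).trans hN₂)
      (fun i => by
        by_cases hi : i = d
        · subst hi
          rw [Function.update_self]
          have := hκ i
          omega
        · rw [Function.update_of_ne hi]; exact (hκ₁ i).trans hN₂)
      (Function.update_self _ _ _)
    have hs : s + 1 + (n * (s + 1) + 1) = (n + 1) * (s + 1) + 1 := by ring
    rw [mul_pow_split, hs] at hκ₃ hσ₃ ht₃
    refine ⟨κ₃, _, .loop_step (by rw [eval_ctr, hn]; omega) (.seq hE₁ hE₂) hE₃, ?_, hκ₃, hσ₃, ?_⟩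
    · intro i hi
      rw [hd₃ i hi, Function.update_of_ne (by omega), hd₁ i (by omega)]
    · have hle : s ≤ (n + 1) * (s + 1) + 1 := by nlinarith
      have m₀ := hcost.trans (Nat.mul_le_mul_left _ (sq_size_mono
        (le_mul_pow h0 N (3 * ((n + 1) * (s + 1) + 1)))))
      have m₁ := ht₁.trans (Nat.mul_le_mul_left _ (sq_size_mono (mul_pow_mono h0 N hle)))
      have m₂ := ht₂.trans (Nat.mul_le_mul_left _ (sq_size_mono (mul_pow_mono h0 N hle)))
      rw [hw] at m₂
      rw [hc] at m₀
      generalize Nat.size (N * I 0 ^ (3 * ((n + 1) * (s + 1) + 1)) + 2) ^ 2 = S at *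
      have e₀ : c * S ≤ c * S * (s + 1) := Nat.le_mul_of_pos_right _ (by omega)
      have e₁ : C * s * S ≤ C * (s + 1) * S := by gcongr; omega
      have e₂ : w * S ≤ w * S * (s + 1) := Nat.le_mul_of_pos_right _ (by omega)
      calc _ ≤ c * S * (s + 1) + (C * (s + 1) * S + w * S * (s + 1)) +
              (C + w + c) * (n * (s + 1) + 1) * S := by omega
        _ = _ := by ring

theorem Cmd.runs_toProg {I : Mem} (hI : ∀ i, I i ≤ I 0) (h0 : 1 ≤ I 0) (A : Cmd) (hA : A.Tame I)
    (d : ℕ) (σ κ : Mem) (N : ℕ) (hN : I 0 ≤ N) (hσ : ∀ i, σ i ≤ N) (hκ : ∀ i, κ i ≤ N) :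
    Runs I (A.toProg d) d σ (A.run I σ) κ N (A.steps (I 0)) (A.weight d) := by
  induction A generalizing d σ κ N with
  | set k e =>
    have hM := layout_le (fun i => (hI i).trans hN) hσ hκ
    have hE := Exec.assign (varAddr k) e.toExpr (layout I σ κ)
    rw [eval_varAddr, update_layout_var, eval_toExpr] at hE
    have hc := assign_cost_le hM (varAddr k) e.toExpr
    rw [eval_varAddr, eval_toExpr] at hc
    refine ⟨κ, _, hE, fun _ _ => rfl, fun i => (hκ i).trans (le_mul_pow h0 _ _), ?_, ?_⟩
    · intro i
      simp only [Cmd.run, Cmd.steps, mul_one]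
      by_cases hi : i = k
      · subst hi; rw [Function.update_self]; exact hA σ N hN hσ
      · rw [Function.update_of_ne hi]; exact (hσ i).trans (le_mul_pow h0 _ _)
    · refine hc.trans ?_
      simp only [Cmd.steps, Cmd.weight, mul_one]
      exact Nat.mul_le_mul_left _ (sq_size_mono (le_mul_pow h0 _ _))
  | seq A B ihA ihB =>
    refine Runs.seq h0 ((ihA hA.1 d σ κ N hN hσ hκ).mono h0 le_rfl (Nat.le_add_right _ _)) ?_
    intro κ' hκ' hσ'
    exact (ihB hA.2 d _ κ' _ (hN.trans (le_mul_pow h0 _ _)) hσ' hκ').mono h0 le_rfl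
      (Nat.le_add_left _ _)
  | ifz c A ih =>
    have hcost := c.toExpr.cost_le (layout_le (fun i => (hI i).trans hN) hσ hκ)
    have hS := one_le_sq_size (N * I 0 ^ (3 * (A.steps (I 0) + 1)))
    replace hcost := hcost.trans (Nat.mul_le_mul_left _ (sq_size_mono
        (le_mul_pow h0 N (3 * (A.steps (I 0) + 1)))))
    by_cases hc : c.val I σ = 0
    · obtain ⟨κ', t, hE, hd, hκ', hσ', ht⟩ := (ih hA d σ κ N hN hσ hκ).mono h0
        (Nat.le_succ _) le_rfl
      have hrun : (Cmd.ifz c A).run I σ = A.run I σ := by simp [Cmd.run, hc]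
      refine ⟨κ', _, .ite_false (by rw [eval_toExpr, hc]) (hrun ▸ hE), hd, hκ', hrun ▸ hσ', ?_⟩
      simp only [Cmd.steps, Cmd.weight] at *
      generalize Nat.size (N * I 0 ^ (3 * (A.steps (I 0) + 1)) + 2) ^ 2 = S at *
      generalize A.steps (I 0) = n at *
      nlinarith [Nat.zero_le (c.toExpr.weight * S * n), Nat.zero_le (S * n)]
    · have hrun : (Cmd.ifz c A).run I σ = σ := by simp [Cmd.run, hc]
      refine ⟨κ, _, .ite_true (by rwa [eval_toExpr]) (by rw [hrun]; exact Exec.skip _), fun _ _ => rfl,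
        fun i => (hκ i).trans (le_mul_pow h0 _ _),
        fun i => by rw [hrun]; exact (hσ i).trans (le_mul_pow h0 _ _), ?_⟩
      simp only [Cmd.steps, Cmd.weight] at *
      generalize Nat.size (N * I 0 ^ (3 * (A.steps (I 0) + 1)) + 2) ^ 2 = S at *
      generalize A.steps (I 0) = n at *
      nlinarith [Nat.zero_le (c.toExpr.weight * S * n), Nat.zero_le (S * n),
        Nat.zero_le (A.weight d * (n + 1) * S)]
  | rep m A ih =>
    obtain ⟨t, hE, ht⟩ := exec_assign_ctr (fun i => (hI i).trans hN) hσ hκ d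
      (.sub (.mem (.const 0)) (.const m))
    have hval : (Expr.sub (.mem (.const 0)) (.const m)).eval (layout I σ κ) = I 0 - m := by
      simp [Expr.eval, layout_input]
    rw [hval] at hE
    obtain ⟨κ', t', hE', hd, hκ', hσ', ht'⟩ := (Runs.loop hI h0 (ih hA (d + 1)) (I 0 - m) σ
      (Function.update κ d (I 0 - m)) N hN hσ (fun i => by
        by_cases hi : i = d
        · subst hi; rw [Function.update_self]; omega
        · rw [Function.update_of_ne hi]; exact hκ i) (Function.update_self _ _ _)).mono h0
      (s' := I 0 * (A.steps (I 0) + 1) + 1)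
      (Nat.succ_le_succ (Nat.mul_le_mul_right _ (Nat.sub_le _ _))) le_rfl
    refine ⟨κ', t + t', .seq hE hE', ?_, hκ', hσ', ?_⟩
    · intro i hi
      rw [hd i hi, Function.update_of_ne (by omega)]
    · have m₀ := ht.trans (Nat.mul_le_mul_left _ (sq_size_mono
        (le_mul_pow h0 N (3 * (I 0 * (A.steps (I 0) + 1) + 1)))))
      simp only [Cmd.steps, Cmd.weight]
      generalize Nat.size (N * I 0 ^ (3 * (I 0 * (A.steps (I 0) + 1) + 1)) + 2) ^ 2 = S at *
      generalize assignWeight (ctrAddr d) (.sub (.mem (.const 0)) (.const m)) = w₀ at *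
      generalize assignWeight (ctrAddr d) (.sub (.mem (ctrAddr d)) (.const 1)) = w at *
      generalize (Expr.mem (ctrAddr d)).weight = c at *
      generalize I 0 * (A.steps (I 0) + 1) = n at *
      calc t + t' ≤ w₀ * S + (A.weight (d + 1) + w + c) * (n + 1) * S := Nat.add_le_add m₀ ht'
        _ ≤ w₀ * (n + 1) * S + (A.weight (d + 1) + w + c) * (n + 1) * S := by
          gcongr
          exact Nat.le_mul_of_pos_right _ (by omega)
        _ = _ := by ring

/-- Each nested loop contributes one factor `p`, so the degree is governed by the program text
alone. -/
theorem Cmd.exists_steps_le (A : Cmd) : ∃ K m : ℕ, ∀ p, 1 ≤ p → A.steps p + 1 ≤ K * p ^ m := by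
  induction A with
  | set k e => exact ⟨2, 0, fun p hp => by simp [Cmd.steps]⟩
  | seq A B hA hB =>
    obtain ⟨K, m, h⟩ := hA
    obtain ⟨K', m', h'⟩ := hB
    refine ⟨K + K', m + m', fun p hp => ?_⟩
    have h1 : p ^ m ≤ p ^ (m + m') := Nat.pow_le_pow_right hp (by omega)
    have h2 : p ^ m' ≤ p ^ (m + m') := Nat.pow_le_pow_right hp (by omega)
    have h3 := (h p hp).trans (Nat.mul_le_mul_left K h1)
    have h4 := (h' p hp).trans (Nat.mul_le_mul_left K' h2)
    simp only [Cmd.steps, add_mul]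
    omega
  | ifz c A hA =>
    obtain ⟨K, m, h⟩ := hA
    refine ⟨K + 1, m, fun p hp => ?_⟩
    have h1 : 1 ≤ p ^ m := Nat.one_le_pow _ _ hp
    have h2 := h p hp
    simp only [Cmd.steps, add_mul]
    omega
  | rep j A hA =>
    obtain ⟨K, m, h⟩ := hA
    refine ⟨K + 2, m + 1, fun p hp => ?_⟩
    have h1 : 1 ≤ p ^ (m + 1) := Nat.one_le_pow _ _ hp
    have h2 := Nat.mul_le_mul_left p (h p hp)
    have h3 : p * (K * p ^ m) = K * p ^ (m + 1) := by ring
    simp only [Cmd.steps, add_mul]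
    omega

/-- The compiled command, followed by copying register `k` to the output cell. -/
def Cmd.toProgram (A : Cmd) (k : ℕ) : Prog :=
  .seq (A.toProg 0) (.assign (.const 0) (.mem (varAddr k)))

theorem Cmd.exists_outputsWithin (A : Cmd) (k : ℕ) :
    ∃ K m : ℕ, ∀ (l : List ℕ) (p : ℕ), 2 ≤ p → l.length = 3 * p + 2 → l.getD 0 0 = p →
      (∀ x ∈ l, x ≤ p) → A.Tame (init l) →
        OutputsWithin (A.toProgram k) l (A.run (init l) 0 k) ((K * p ^ m : ℕ) : ℝ) := by
  obtain ⟨K, m, hK⟩ := A.exists_steps_le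
  set W := A.weight 0 + assignWeight (.const 0) (.mem (varAddr k)) with hW
  -- With `s` steps, numbers have length at most `5 (s + 1) p`. The cost is at most `W (s + 1)`
  -- times the square of this, and `s + 1 ≤ K p ^ m`.
  refine ⟨25 * W * K ^ 3, 3 * m + 2, fun l p hp hl h0 hle hA => ?_⟩
  have hI0 : init l 0 = p := h0
  have hI : ∀ i, init l i ≤ init l 0 := by
    intro i
    rw [hI0]
    rcases lt_or_ge i l.length with hi | hi
    · have : init l i = l[i] := by simp [init, hi]
      rw [this]
      exact hle _ (List.getElem_mem hi)
    · have : init l i = 0 := by simp [init, hi]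
      omega
  have hinit : layout (init l) 0 0 = init l := by
    funext i
    unfold layout
    split_ifs with h1 h2
    · rfl
    all_goals
      rw [hI0, not_lt] at h1
      simp [init, show l.length ≤ i by omega]
  have h1 : 1 ≤ init l 0 := by omega
  obtain ⟨κ, t, hE, -, hκ, hσ, ht⟩ := A.runs_toProg hI h1 hA 0 0 0 (init l 0) le_rfl
    (fun _ => Nat.zero_le _) (fun _ => Nat.zero_le _)
  rw [hinit] at hE
  have hE' := Exec.assign (.const 0) (.mem (varAddr k)) (layout (init l) (A.run (init l) 0) κ)
  have ht' := assign_cost_le (layout_le (fun i => (hI i).trans (le_mul_pow h1 _ _)) hσ hκ)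
    (.const 0) (.mem (varAddr k))
  refine ⟨_, _, .seq hE hE', ?_, ?_⟩
  · simp only [Expr.eval, eval_varAddr, layout_var, Function.update_self]
  · rw [Nat.cast_le]
    rw [hI0] at ht ht'
    have hs := hK p (by omega)
    generalize A.steps p = s at *
    have hsize : Nat.size (p * p ^ (3 * s) + 2) ≤ 5 * (s + 1) * p := by
      have h2 : p * p ^ (3 * s) + 2 ≤ p ^ (3 * s + 2) := by
        have h3 : 1 ≤ p ^ (3 * s) := Nat.one_le_pow _ _ (by omega)
        have h5 : 2 * (p * p ^ (3 * s)) ≤ p * (p * p ^ (3 * s)) := Nat.mul_le_mul_right _ hp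
        have h6 : p ^ (3 * s + 2) = p * (p * p ^ (3 * s)) := by ring
        nlinarith
      refine (size_pow_le (by omega) h2).trans ?_
      have h4 : Nat.size p ≤ p := Nat.size_le.2 Nat.lt_two_pow_self
      exact Nat.mul_le_mul (by omega) h4
    have hS := Nat.pow_le_pow_left hsize 2
    generalize Nat.size (p * p ^ (3 * s) + 2) ^ 2 = S at *
    calc _ ≤ A.weight 0 * s * S + assignWeight (.const 0) (.mem (varAddr k)) * S :=
          Nat.add_le_add ht ht'
      _ ≤ A.weight 0 * (s + 1) * S + assignWeight (.const 0) (.mem (varAddr k)) * (s + 1) * S := by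
          gcongr
          · omega
          · exact Nat.le_mul_of_pos_right _ (by omega)
      _ = W * (s + 1) * S := by rw [hW]; ring
      _ ≤ W * (s + 1) * (5 * (s + 1) * p) ^ 2 := Nat.mul_le_mul_left _ hS
      _ = 25 * W * (s + 1) ^ 3 * p ^ 2 := by ring
      _ ≤ 25 * W * (K * p ^ m) ^ 3 * p ^ 2 := by gcongr
      _ = _ := by ring

end RAM

/-! ### Encoding of ring elements by natural numbers -/

section Encoding

variable {F : Type*} [CommRing F]

/-- The number `n` encodes `x`: there is a polynomial of degree less than `p` with coefficients in
`{0, …, K}` whose value at `B` is `n` and whose value at `Y` is `x`. -/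
def Enc (p B : ℕ) (Y : F) (K n : ℕ) (x : F) : Prop :=
  ∃ f : ℕ → ℕ, (∀ i, f i ≤ K) ∧ n = ∑ i ∈ Finset.range p, f i * B ^ i ∧
    x = ∑ i ∈ Finset.range p, (f i : F) * Y ^ i

theorem sum_mul_pow_lt {B : ℕ} {f : ℕ → ℕ} (hf : ∀ i, f i < B) (n : ℕ) :
    ∑ i ∈ Finset.range n, f i * B ^ i < B ^ n := by
  induction n with
  | zero => simp
  | succ n ih =>
    rw [Finset.sum_range_succ, pow_succ]
    have h1 : (f n + 1) * B ^ n ≤ B * B ^ n := Nat.mul_le_mul_right _ (hf n)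
    nlinarith

/-- Digits below `B` produce no carries, and `p ∣ B` kills the higher digits modulo `p`. A single
remainder thus extracts a digit and reduces it. -/
theorem sum_mul_pow_div_mod {B p : ℕ} (hB : 1 ≤ B) (hp : p ∣ B) {f : ℕ → ℕ} (hf : ∀ i, f i < B)
    {n j : ℕ} (hj : j < n) :
    (∑ i ∈ Finset.range n, f i * B ^ i) / B ^ j % p = f j % p := by
  induction j generalizing n f with
  | zero =>
    obtain ⟨n, rfl⟩ : ∃ m, n = m + 1 := ⟨n - 1, by omega⟩
    obtain ⟨b, rfl⟩ := hp
    rw [Finset.sum_range_succ', pow_zero, Nat.div_one, mul_one]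
    have : ∑ i ∈ Finset.range n, f (i + 1) * (p * b) ^ (i + 1) =
        p * ∑ i ∈ Finset.range n, f (i + 1) * ((p * b) ^ i * b) := by
      rw [Finset.mul_sum]
      exact Finset.sum_congr rfl fun i _ => by ring
    rw [this, Nat.mul_add_mod]
  | succ j ih =>
    obtain ⟨n, rfl⟩ : ∃ m, n = m + 1 := ⟨n - 1, by omega⟩
    have : ∑ i ∈ Finset.range (n + 1), f i * B ^ i =
        f 0 + B * ∑ i ∈ Finset.range n, f (i + 1) * B ^ i := by
      rw [Finset.sum_range_succ', Finset.mul_sum, add_comm]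
      congr 1
      · simp
      · exact Finset.sum_congr rfl fun i _ => by ring
    rw [this, pow_succ', ← Nat.div_div_eq_div_mul, Nat.add_mul_div_left _ _ (by omega),
      Nat.div_eq_of_lt (hf 0), zero_add]
    exact ih (fun i => hf (i + 1)) (by omega)

/-- Multiplication by `b` with the overflowing top coefficient replaced by a multiple of `c`. It is
used both at `b = Y` in `F` and at `b = B` in `ℤ`, which is what ties the code to the element. -/
theorem sum_shift_mul_pow {R : Type*} [CommRing R] (f c : ℕ → ℕ) (q : ℕ) (b : R) :
    (∑ i ∈ Finset.range (q + 1), (((if i = 0 then 0 else f (i - 1)) + f q * c i : ℕ) : R) * b ^ i)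
      + f q * b ^ (q + 1) =
    b * (∑ i ∈ Finset.range (q + 1), (f i : R) * b ^ i) +
      f q * ∑ i ∈ Finset.range (q + 1), (c i : R) * b ^ i := by
  have h1 : ∑ i ∈ Finset.range (q + 1), ((if i = 0 then 0 else f (i - 1) : ℕ) : R) * b ^ i =
      b * ∑ i ∈ Finset.range q, (f i : R) * b ^ i := by
    rw [Finset.sum_range_succ', Finset.mul_sum]
    simp only [Nat.add_sub_cancel, Nat.succ_ne_zero, if_false, if_true, Nat.cast_zero, zero_mul,
      add_zero]
    exact Finset.sum_congr rfl fun i _ => by ring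
  simp only [Nat.cast_add, add_mul, Finset.sum_add_distrib, h1, Nat.cast_mul]
  rw [Finset.sum_range_succ (fun i => (f i : R) * b ^ i)]
  simp only [mul_assoc, ← Finset.mul_sum]
  ring

namespace Enc

variable {p B : ℕ} {Y : F}

theorem mono {K K' n : ℕ} {x : F} (h : Enc p B Y K n x) (hK : K ≤ K') : Enc p B Y K' n x := by
  obtain ⟨f, hf, h⟩ := h
  exact ⟨f, fun i => (hf i).trans hK, h⟩

theorem zero : Enc p B Y 0 0 0 := ⟨0, by simp, by simp, by simp⟩

theorem natCast (hp : 1 ≤ p) (k : ℕ) : Enc p B Y k k (k : F) := by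
  obtain ⟨p, rfl⟩ : ∃ m, p = m + 1 := ⟨p - 1, by omega⟩
  refine ⟨fun i => if i = 0 then k else 0, fun i => by dsimp only; split_ifs <;> omega, ?_, ?_⟩ <;> simp

theorem add {K K' n m : ℕ} {x y : F} (hn : Enc p B Y K n x) (hm : Enc p B Y K' m y) :
    Enc p B Y (K + K') (n + m) (x + y) := by
  obtain ⟨f, hf, rfl, rfl⟩ := hn
  obtain ⟨g, hg, rfl, rfl⟩ := hm
  refine ⟨fun i => f i + g i, fun i => Nat.add_le_add (hf i) (hg i), ?_, ?_⟩
  · simp [add_mul, Finset.sum_add_distrib]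
  · simp [add_mul, Finset.sum_add_distrib]

theorem smul {K n : ℕ} {x : F} (c : ℕ) (hn : Enc p B Y K n x) :
    Enc p B Y (c * K) (c * n) (c * x) := by
  obtain ⟨f, hf, rfl, rfl⟩ := hn
  refine ⟨fun i => c * f i, fun i => Nat.mul_le_mul_left c (hf i), ?_, ?_⟩
  · simp [mul_assoc, Finset.mul_sum]
  · simp [mul_assoc, Finset.mul_sum]

theorem sum {K : ℕ} {n : ℕ → ℕ} {x : ℕ → F} (s : ℕ) (h : ∀ i < s, Enc p B Y K (n i) (x i)) :
    Enc p B Y (s * K) (∑ i ∈ Finset.range s, n i) (∑ i ∈ Finset.range s, x i) := by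
  induction s with
  | zero => simpa using zero
  | succ s ih =>
    rw [Finset.sum_range_succ, Finset.sum_range_succ, add_mul, one_mul]
    exact (ih fun i hi => h i (by omega)).add (h s (by omega))

theorem lt {K n : ℕ} {x : F} (h : Enc p B Y K n x) (hK : K < B) : n < B ^ p := by
  obtain ⟨f, hf, rfl, rfl⟩ := h
  exact sum_mul_pow_lt (fun i => (hf i).trans_lt hK) p

/-- Replacing `Y ^ p` by `∑ c i * Y ^ i` corresponds to subtracting a multiple of `U` from the code.
As the `c i` are nonnegative, the new digits are too, and their bound grows only by the factor `p`.
-/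
theorem shift {c : ℕ → ℕ} {U K n : ℕ} {x : F} (hp : 1 ≤ p)
    (hc : ∀ i, c i ≤ p - 1) (hU : U + ∑ i ∈ Finset.range p, c i * B ^ i = B ^ p)
    (hY : Y ^ p = ∑ i ∈ Finset.range p, (c i : F) * Y ^ i) (h : Enc p B Y K n x) :
    ∃ m, Enc p B Y (p * K) m (Y * x) ∧ m ≡ B * n [MOD U] := by
  obtain ⟨f, hf, rfl, rfl⟩ := h
  obtain ⟨q, rfl⟩ : ∃ q, p = q + 1 := ⟨p - 1, by omega⟩
  refine ⟨∑ i ∈ Finset.range (q + 1), ((if i = 0 then 0 else f (i - 1)) + f q * c i) * B ^ i,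
    ⟨_, fun i => ?_, rfl, ?_⟩, ?_⟩
  · have h1 : f q * c i ≤ K * q := Nat.mul_le_mul (hf q) (hc i)
    have h2 : (if i = 0 then 0 else f (i - 1)) ≤ K := by
      split_ifs
      · omega
      · exact hf _
    nlinarith
  · have := sum_shift_mul_pow f c q Y
    rw [← hY] at this
    linear_combination -this
  · have h1 := sum_shift_mul_pow f c q (B : ℤ)
    have h2 : (U : ℤ) + ∑ i ∈ Finset.range (q + 1), (c i : ℤ) * (B : ℤ) ^ i = (B : ℤ) ^ (q + 1) := by
      exact_mod_cast hU
    refine (Int.natCast_modEq_iff.1 (Int.modEq_iff_dvd.2 ⟨f q, ?_⟩))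
    push_cast at h1 ⊢
    linear_combination (-(f q : ℤ)) * h2 - h1

/-- Shift `x` up to `p` times and combine the results with the digits of `y` as weights. The bound
collects `p ^ p` from the shifts, `K'` from the weights and `p` from the summation. -/
theorem exists_mul {c : ℕ → ℕ} {U K K' n m : ℕ} {x y : F} (hp : 1 ≤ p)
    (hc : ∀ i, c i ≤ p - 1) (hU : U + ∑ i ∈ Finset.range p, c i * B ^ i = B ^ p)
    (hY : Y ^ p = ∑ i ∈ Finset.range p, (c i : F) * Y ^ i) (hn : Enc p B Y K n x)
    (hm : Enc p B Y K' m y) :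
    ∃ r, Enc p B Y (p * (K' * (p ^ p * K))) r (x * y) ∧ r ≡ n * m [MOD U] := by
  have hpow : ∀ k, ∃ r, Enc p B Y (p ^ k * K) r (Y ^ k * x) ∧ r ≡ B ^ k * n [MOD U] := by
    intro k
    induction k with
    | zero => exact ⟨n, by simpa using hn, by simpa using Nat.ModEq.refl n⟩
    | succ k ih =>
      obtain ⟨r, hr, hr'⟩ := ih
      obtain ⟨s, hs, hs'⟩ := shift hp hc hU hY hr
      refine ⟨s, ?_, ?_⟩
      · rw [pow_succ', pow_succ', mul_assoc, mul_assoc]; exact hs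
      · rw [pow_succ', mul_assoc]; exact hs'.trans (hr'.mul_left B)
  choose r hr hr' using hpow
  obtain ⟨f, hf, rfl, rfl⟩ := hm
  refine ⟨∑ k ∈ Finset.range p, f k * r k, ?_, ?_⟩
  · have : x * ∑ i ∈ Finset.range p, (f i : F) * Y ^ i =
        ∑ i ∈ Finset.range p, (f i : F) * (Y ^ i * x) := by
      rw [Finset.mul_sum]
      exact Finset.sum_congr rfl fun i _ => by ring
    rw [this]
    refine sum p fun k hk => ((hr k).smul (f k)).mono ?_
    have h1 : p ^ k ≤ p ^ p := Nat.pow_le_pow_right hp hk.le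
    exact Nat.mul_le_mul (hf k) (Nat.mul_le_mul_right K h1)
  · rw [Finset.mul_sum]
    refine Nat.ModEq.sum fun k _ => ?_
    have := (hr' k).mul_left (f k)
    convert this using 1
    ring

theorem mul_mod {c : ℕ → ℕ} {U n m : ℕ} {x y : F} (hp : 1 ≤ p)
    (hc : ∀ i, c i ≤ p - 1) (hU : U + ∑ i ∈ Finset.range p, c i * B ^ i = B ^ p)
    (hY : Y ^ p = ∑ i ∈ Finset.range p, (c i : F) * Y ^ i) (hB : p ^ (p + 3) + p ≤ B)
    (hn : Enc p B Y (p - 1) n x) (hm : Enc p B Y (p - 1) m y) :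
    Enc p B Y (p ^ (p + 3)) (n * m % U) (x * y) := by
  obtain ⟨r, hr, hr'⟩ := exists_mul hp hc hU hY hn hm
  have hle : p * ((p - 1) * (p ^ p * (p - 1))) ≤ p ^ (p + 3) := by
    calc p * ((p - 1) * (p ^ p * (p - 1))) ≤ p * (p * (p ^ p * p)) := by gcongr <;> omega
      _ = _ := by ring
  replace hr := hr.mono hle
  -- The digits of `r` plus the `c i` stay below `B`, so `r + ∑ c i * B ^ i < B ^ p`, which is `r <
  -- U`. The remainder is therefore `r` itself.
  have hlt : r < U := by
    obtain ⟨f, hf, rfl, -⟩ := hr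
    have h1 := sum_mul_pow_lt (B := B) (f := fun i => f i + c i)
      (fun i => by have := hf i; have := hc i; omega) p
    simp only [add_mul, Finset.sum_add_distrib] at h1
    omega
  have : n * m % U = r := by rw [← hr', Nat.mod_eq_of_lt hlt]
  rwa [this]

theorem normalize [CharP F p] {K n : ℕ} {x : F} (hp : 1 ≤ p) (hB : p ∣ B) (hK : K < B)
    (h : Enc p B Y K n x) :
    Enc p B Y (p - 1) (∑ i ∈ Finset.range p, n / B ^ i % p * B ^ i) x := by
  obtain ⟨f, hf, rfl, rfl⟩ := h
  refine ⟨fun i => f i % p, fun i => Nat.le_sub_one_of_lt (Nat.mod_lt _ hp), ?_, ?_⟩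
  · refine Finset.sum_congr rfl fun i hi => ?_
    rw [sum_mul_pow_div_mod (by omega) hB (fun i => (hf i).trans_lt hK) (Finset.mem_range.1 hi)]
  · refine Finset.sum_congr rfl fun i _ => ?_
    congr 1
    exact (CharP.cast_eq_iff_mod_eq F p).2 (Nat.mod_mod _ _).symm

/-- The hypothesis `hY` is linear independence of the first `p` powers of `Y` over `𝔽_p`; a digit
below `p` and divisible by `p` is zero. -/
theorem eq_zero_iff {n : ℕ} {x : F} (hp : 1 ≤ p) (hB : 1 ≤ B)
    (hY : ∀ f : ℕ → ℕ, ∑ i ∈ Finset.range p, (f i : F) * Y ^ i = 0 → ∀ i < p, p ∣ f i)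
    (h : Enc p B Y (p - 1) n x) : n = 0 ↔ x = 0 := by
  obtain ⟨f, hf, rfl, rfl⟩ := h
  constructor
  · intro h0
    refine Finset.sum_eq_zero fun i hi => ?_
    have := Finset.sum_eq_zero_iff.1 h0 i hi
    have hpos : B ^ i ≠ 0 := (Nat.pow_pos hB).ne'
    simp [(mul_eq_zero.1 this).resolve_right hpos]
  · intro h0
    refine Finset.sum_eq_zero fun i hi => ?_
    have := Nat.eq_zero_of_dvd_of_lt (hY f h0 i (Finset.mem_range.1 hi))
      (by have := hf i; omega)
    simp [this]

end Enc

end Encoding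

/-! ### Arithmetic of an Artin–Schreier generator -/

section ArtinSchreier

open Polynomial

/-- The sum of the `p ^ j`-th powers of `x` for `j < p`; for `x` in a field with `p ^ p` elements
it is the trace of `x` over the prime field. -/
def frobSum {F : Type*} [Field F] (p : ℕ) (x : F) : F := ∑ j ∈ Finset.range p, x ^ p ^ j

open Classical in
/-- One trial division by the conjugate of `g` that belongs to `h`. -/
noncomputable def trialStep {F : Type*} [Field F] (p : ℕ) (h : F) (P : ℕ) (s : F × ℕ) : F × ℕ :=
  if frobSum p (s.1 * h) = 0 then (s.1 * h, s.2 + P) else s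

/-- Determination of one digit of the discrete logarithm: the components of the state are the
remaining target, the current divisor, the sum of the digits found and the current power of `p`. -/
noncomputable def digitStep {F : Type*} [Field F] (p : ℕ) (s : F × F × ℕ × ℕ) : F × F × ℕ × ℕ :=
  let r := (trialStep p s.2.1 s.2.2.2)^[p] (s.1, s.2.2.1)
  (r.1, s.2.1 ^ p, r.2, s.2.2.2 * p)

variable {p : ℕ} [hp : Fact p.Prime] {F : Type*} [Field F] [Algebra (ZMod p) F]

theorem aeval_pow_char (x : F) (P : (ZMod p)[X]) : aeval x P ^ p = aeval (x ^ p) P := by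
  rw [← map_pow, ← ZMod.expand_card, expand_aeval]

theorem aeval_pow_char_pow (x : F) (P : (ZMod p)[X]) (j : ℕ) :
    aeval x P ^ p ^ j = aeval (x ^ p ^ j) P := by
  induction j with
  | zero => simp
  | succ j ih => rw [pow_succ, pow_mul, ih, aeval_pow_char, ← pow_mul]

theorem sum_range_natCast_pow {k : ℕ} (hk : k < p) :
    ∑ j ∈ Finset.range p, (j : ZMod p) ^ k = if k = p - 1 then -1 else 0 := by
  have hbij : ∑ j ∈ Finset.range p, (j : ZMod p) ^ k = ∑ x : ZMod p, x ^ k := by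
    refine Finset.sum_bij' (fun j _ => (j : ZMod p)) (fun x _ => x.val) ?_ ?_ ?_ ?_ ?_
    · simp
    · intro x _; exact Finset.mem_range.2 x.val_lt
    · intro j hj; exact ZMod.val_cast_of_lt (Finset.mem_range.1 hj)
    · intro x _; exact ZMod.natCast_zmod_val x
    · simp
  rw [hbij]
  split_ifs with h
  · subst h
    have h0 : p - 1 ≠ 0 := by have := hp.out.two_le; omega
    rw [← Finset.add_sum_erase _ _ (Finset.mem_univ (0 : ZMod p)), zero_pow h0, zero_add,
      Finset.sum_congr rfl fun x hx => ZMod.pow_card_sub_one_eq_one (Finset.ne_of_mem_erase hx)]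
    simp [Finset.card_erase_of_mem, ZMod.card, Nat.cast_sub hp.out.one_le]
  · refine FiniteField.sum_pow_lt_card_sub_one _ _ ?_
    rw [ZMod.card]
    omega

/-- Expand each `(x + j a) ^ m` by the binomial theorem and sum over `j` first. The power sums
vanish except for exponent `p - 1`, which forces `m = p - 1` and the term free of `x`, where `a ^ (p
- 1) = 1`. -/
theorem sum_aeval_add_natCast_mul (x : F) {a : ZMod p} (ha : a ≠ 0) {P : (ZMod p)[X]}
    (hP : P.natDegree < p) :
    ∑ j ∈ Finset.range p, aeval (x + j * algebraMap (ZMod p) F a) P =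
      -algebraMap (ZMod p) F (P.coeff (p - 1)) := by
  have hp1 := hp.out.one_le
  have hpow : ∀ m < p, ∑ j ∈ Finset.range p, (x + j * algebraMap (ZMod p) F a) ^ m =
      if m = p - 1 then -1 else 0 := by
    intro m hm
    have hterm : ∀ k ∈ Finset.range (m + 1), ∑ j ∈ Finset.range p,
        (x ^ k * ((j : F) * algebraMap (ZMod p) F a) ^ (m - k) * (m.choose k : F)) =
        if k = 0 then (if m = p - 1 then -1 else 0) else 0 := by
      intro k hk
      have h1 : ∀ j ∈ Finset.range p,
          x ^ k * ((j : F) * algebraMap (ZMod p) F a) ^ (m - k) * (m.choose k : F) =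
          x ^ k * (m.choose k : F) * algebraMap (ZMod p) F a ^ (m - k) *
            algebraMap (ZMod p) F ((j : ZMod p) ^ (m - k)) := by
        intro j _
        rw [map_pow, map_natCast]
        ring
      rw [Finset.sum_congr rfl h1, ← Finset.mul_sum, ← map_sum,
        sum_range_natCast_pow (by omega : m - k < p)]
      by_cases hk0 : k = 0
      · subst hk0
        by_cases hmp : m = p - 1
        · subst hmp
          simp [← map_pow, ZMod.pow_card_sub_one_eq_one ha]
        · simp [hmp]
      · have : m - k ≠ p - 1 := by have := Finset.mem_range.1 hk; omega
        simp [hk0, this]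
    simp only [add_pow]
    rw [Finset.sum_comm, Finset.sum_congr rfl hterm]
    simp
  simp only [aeval_eq_sum_range' hP]
  rw [Finset.sum_comm]
  simp only [← Finset.smul_sum]
  rw [Finset.sum_congr rfl fun m hm => by rw [hpow m (Finset.mem_range.1 hm)]]
  rw [Finset.sum_eq_single (p - 1)]
  · simp [Algebra.smul_def]
  · intro m _ hm; simp [hm]
  · intro h; exact absurd (Finset.mem_range.2 (by omega)) h

variable {g : F} {a : ZMod p}

theorem pow_char_pow_eq (hg : g ^ p = g + algebraMap (ZMod p) F a) (j : ℕ) :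
    g ^ p ^ j = g + j * algebraMap (ZMod p) F a := by
  have : CharP F p := charP_of_injective_algebraMap (algebraMap (ZMod p) F).injective p
  induction j with
  | zero => simp
  | succ j ih =>
    have h1 : ((j : F) * algebraMap (ZMod p) F a) ^ p = j * algebraMap (ZMod p) F a := by
      rw [← map_natCast (algebraMap (ZMod p) F), ← map_mul, ← map_pow, ZMod.pow_card]
    rw [pow_succ, pow_mul, ih, add_pow_char, h1, hg]
    push_cast
    ring

theorem frobSum_aeval (hg : g ^ p = g + algebraMap (ZMod p) F a) (ha : a ≠ 0) {P : (ZMod p)[X]}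
    (hP : P.natDegree < p) :
    frobSum p (aeval g P) = -algebraMap (ZMod p) F (P.coeff (p - 1)) := by
  rw [← sum_aeval_add_natCast_mul g ha hP]
  exact Finset.sum_congr rfl fun j _ => by rw [aeval_pow_char_pow, pow_char_pow_eq hg]

theorem conj_pow_char (hg : g ^ p = g + algebraMap (ZMod p) F a) (i : ℕ) :
    (g + i * algebraMap (ZMod p) F a) ^ p =
      g + i * algebraMap (ZMod p) F a + algebraMap (ZMod p) F a := by
  rw [← pow_char_pow_eq hg, ← pow_mul, ← pow_succ, pow_char_pow_eq hg, pow_char_pow_eq hg]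
  push_cast
  ring

theorem conj_ne_zero (hg : g ^ p = g + algebraMap (ZMod p) F a) (ha : a ≠ 0) (i : ℕ) :
    g + i * algebraMap (ZMod p) F a ≠ 0 := by
  intro h0
  have := conj_pow_char hg i
  rw [h0, zero_pow hp.out.ne_zero, zero_add] at this
  exact ha ((map_eq_zero _).1 this.symm)

/-- Failing division leaves a nonzero trace: the remainder `R(-i a)` reappears as the coefficient of
`X ^ (p - 1)`, because the inverse of `g + i a` involves its `(p - 1)`-st power. -/
theorem frobSum_mul_ne_zero (hg : g ^ p = g + algebraMap (ZMod p) F a) (ha : a ≠ 0) {i : ℕ} {h : F}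
    (hh : h * (g + i * algebraMap (ZMod p) F a) = algebraMap (ZMod p) F a) {c : ZMod p}
    (hc : c ≠ 0) {R : (ZMod p)[X]} (hR : R.natDegree < p) (hRi : R.eval (-(i * a)) ≠ 0) :
    frobSum p (algebraMap (ZMod p) F c * aeval g R * h) ≠ 0 := by
  have hp2 := hp.out.two_le
  set G := g + i * algebraMap (ZMod p) F a with hG
  have hG0 : G ≠ 0 := conj_ne_zero hg ha i
  -- Both sides multiplied by `G` give `a`, since `G ^ p = G + a`.
  have hh' : h = G ^ (p - 1) - 1 := by
    apply mul_right_cancel₀ hG0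
    have h1 : G ^ (p - 1) * G = G ^ p := by rw [← pow_succ]; congr 1; omega
    rw [hh, sub_mul, h1, conj_pow_char hg i]
    ring
  set H := R /ₘ (X - C (-((i : ZMod p) * a))) with hH
  set ρ := R.eval (-(i * a)) with hρ
  have hdiv : R = C ρ + (X - C (-((i : ZMod p) * a))) * H := by
    conv_lhs => rw [← modByMonic_add_div R (X - C (-((i : ZMod p) * a)))]
    rw [modByMonic_X_sub_C_eq_C_eval]
  -- From `R = ρ + (X + i a) H` and `G * h = a`, the product `R(g) * h` equals `a * H(g) + ρ * (G ^
  -- (p - 1) - 1)`.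
  set Q := C c * (C a * H + C ρ * ((X + C ((i : ZMod p) * a)) ^ (p - 1) - 1)) with hQ
  have hHdeg : H.natDegree < p - 1 := by
    rw [hH, natDegree_divByMonic _ (monic_X_sub_C _), natDegree_X_sub_C]
    omega
  have hlin : aeval g (X + C ((i : ZMod p) * a)) = G := by simp [hG]
  have hval : algebraMap (ZMod p) F c * aeval g R * h = aeval g Q := by
    have h2 : aeval g (X - C (-((i : ZMod p) * a))) = G := by simp [hG]
    have h3 : aeval g R = algebraMap (ZMod p) F ρ + G * aeval g H := by
      conv_lhs => rw [hdiv]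
      rw [map_add, map_mul, h2, aeval_C]
    rw [hQ, map_mul, map_add, map_mul, map_mul, map_sub, map_pow, hlin, h3, aeval_C, aeval_C,
      aeval_C, map_one, ← hh']
    linear_combination (algebraMap (ZMod p) F c * aeval g H) * hh
  have hmonic : ((X + C ((i : ZMod p) * a)) ^ (p - 1)).Monic := (monic_X_add_C _).pow _
  have hdeg : ((X + C ((i : ZMod p) * a)) ^ (p - 1)).natDegree = p - 1 := by
    rw [(monic_X_add_C _).natDegree_pow, natDegree_X_add_C, mul_one]
  have hQdeg : Q.natDegree < p := by
    have h1 : (C a * H).natDegree ≤ p - 1 := (natDegree_C_mul_le _ _).trans hHdeg.le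
    have h2 : (C ρ * ((X + C ((i : ZMod p) * a)) ^ (p - 1) - 1)).natDegree ≤ p - 1 :=
      (natDegree_C_mul_le _ _).trans ((natDegree_sub_le _ _).trans (by rw [hdeg, natDegree_one]; simp))
    have h3 := (natDegree_C_mul_le c _).trans ((natDegree_add_le (C a * H)
      (C ρ * ((X + C ((i : ZMod p) * a)) ^ (p - 1) - 1))).trans (max_le h1 h2))
    rw [← hQ] at h3
    omega
  have hcoeff : Q.coeff (p - 1) = c * ρ := by
    have h1 : ((X + C ((i : ZMod p) * a)) ^ (p - 1)).coeff (p - 1) = 1 := by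
      have := hmonic.coeff_natDegree
      rwa [hdeg] at this
    rw [hQ, coeff_C_mul, coeff_add, coeff_C_mul, coeff_eq_zero_of_natDegree_lt hHdeg, coeff_C_mul,
      coeff_sub, h1, coeff_one, if_neg (by omega)]
    ring
  rw [hval, frobSum_aeval hg ha hQdeg, hcoeff, neg_ne_zero, Ne, map_eq_zero]
  exact mul_ne_zero hc hRi

/-- While a factor `g + i a` is left, the quotient has degree below `p - 1` and the trial succeeds.
Once they are used up, every further trial fails, so any number of trials at least `m` counts
exactly `m`. Each success costs a scalar factor `a`, which is why an unknown `c` is carried along.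
-/
theorem trialStep_iterate (hg : g ^ p = g + algebraMap (ZMod p) F a) (ha : a ≠ 0) {i : ℕ} {h : F}
    (hh : h * (g + i * algebraMap (ZMod p) F a) = algebraMap (ZMod p) F a) {R : (ZMod p)[X]}
    (hRi : R.eval (-(i * a)) ≠ 0) {c : ZMod p} (hc : c ≠ 0) {m : ℕ} (hm : R.natDegree + m < p)
    (P e n : ℕ) :
    ∃ c' : ZMod p, c' ≠ 0 ∧ (trialStep p h P)^[n]
      (algebraMap (ZMod p) F c * (g + i * algebraMap (ZMod p) F a) ^ m * aeval g R, e) =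
      (algebraMap (ZMod p) F c' * (g + i * algebraMap (ZMod p) F a) ^ (m - n) * aeval g R,
        e + min n m * P) := by
  induction n with
  | zero => exact ⟨c, hc, by simp⟩
  | succ n ih =>
    obtain ⟨c', hc', hn⟩ := ih
    rw [Function.iterate_succ_apply', hn]
    set G := g + i * algebraMap (ZMod p) F a with hG
    by_cases hnm : n < m
    · refine ⟨c' * a, mul_ne_zero hc' ha, ?_⟩
      have h1 : G ^ (m - n) = G * G ^ (m - (n + 1)) := by
        rw [← pow_succ']; congr 1; omega
      have h2 : algebraMap (ZMod p) F c' * G ^ (m - n) * aeval g R * h =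
          algebraMap (ZMod p) F (c' * a) * G ^ (m - (n + 1)) * aeval g R := by
        rw [h1, map_mul]
        linear_combination (algebraMap (ZMod p) F c' * G ^ (m - (n + 1)) * aeval g R) * hh
      have h3 : algebraMap (ZMod p) F (c' * a) * G ^ (m - (n + 1)) * aeval g R =
          aeval g (C (c' * a) * (X + C ((i : ZMod p) * a)) ^ (m - (n + 1)) * R) := by
        simp [hG]
      have h4 : (C (c' * a) * (X + C ((i : ZMod p) * a)) ^ (m - (n + 1)) * R).natDegree < p - 1 := by
        have h5 : ((X + C ((i : ZMod p) * a)) ^ (m - (n + 1))).natDegree = m - (n + 1) := by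
          rw [(monic_X_add_C _).natDegree_pow, natDegree_X_add_C, mul_one]
        have h6 := natDegree_mul_le (p := C (c' * a) * (X + C ((i : ZMod p) * a)) ^ (m - (n + 1)))
          (q := R)
        have h7 := natDegree_C_mul_le (c' * a) ((X + C ((i : ZMod p) * a)) ^ (m - (n + 1)))
        omega
      have h8 : frobSum p (algebraMap (ZMod p) F c' * G ^ (m - n) * aeval g R * h) = 0 := by
        rw [h2, h3, frobSum_aeval hg ha (by omega), coeff_eq_zero_of_natDegree_lt h4]
        simp
      rw [trialStep, if_pos h8]
      dsimp only
      rw [h2, min_eq_left hnm.le, min_eq_left (by omega : n + 1 ≤ m)]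
      congr 1
      ring
    · refine ⟨c', hc', ?_⟩
      have h1 : m - n = 0 := by omega
      have h2 : m - (n + 1) = 0 := by omega
      rw [trialStep, if_neg, h1, h2, min_eq_right (by omega), min_eq_right (by omega)]
      dsimp only
      rw [h1, pow_zero, mul_one]
      exact frobSum_mul_ne_zero hg ha hh hc' (by omega) hRi

theorem digitStep_iterate (hg : g ^ p = g + algebraMap (ZMod p) F a) (ha : a ≠ 0) {h : F}
    (hh : h * g = algebraMap (ZMod p) F a) {d : ℕ → ℕ} (hd : ∑ k ∈ Finset.range p, d k < p)
    {n : ℕ} (hn : n ≤ p) :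
    ∃ (c : ZMod p) (h' : F), c ≠ 0 ∧
      h' * (g + n * algebraMap (ZMod p) F a) = algebraMap (ZMod p) F a ∧
      (digitStep p)^[n] (∏ k ∈ Finset.range p, (g + k * algebraMap (ZMod p) F a) ^ d k, h, 0, 1) =
      (algebraMap (ZMod p) F c * ∏ k ∈ Finset.Ico n p, (g + k * algebraMap (ZMod p) F a) ^ d k, h',
        ∑ k ∈ Finset.range n, d k * p ^ k, p ^ n) := by
  induction n with
  | zero => exact ⟨1, h, one_ne_zero, by simpa using hh, by simp⟩
  | succ n ih =>
    obtain ⟨c, h', hc, hh', hit⟩ := ih (by omega)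
    rw [Function.iterate_succ_apply', hit]
    set R : (ZMod p)[X] := ∏ k ∈ Finset.Ico (n + 1) p, (X + C ((k : ZMod p) * a)) ^ d k with hR
    have hRval : aeval g R = ∏ k ∈ Finset.Ico (n + 1) p,
        (g + k * algebraMap (ZMod p) F a) ^ d k := by
      simp [hR, map_prod]
    -- The conjugates still to come are distinct from the current one: `k - n` lies strictly between
    -- `0` and `p`.
    have hRi : R.eval (-(n * a)) ≠ 0 := by
      rw [hR, eval_prod, Finset.prod_ne_zero_iff]
      intro k hk
      rw [Finset.mem_Ico] at hk
      rw [eval_pow]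
      refine pow_ne_zero _ ?_
      have h1 : ((k - n : ℕ) : ZMod p) ≠ 0 := by
        rw [Ne, ZMod.natCast_eq_zero_iff]
        exact Nat.not_dvd_of_pos_of_lt (by omega) (by omega)
      have h2 : (X + C ((k : ZMod p) * a)).eval (-((n : ZMod p) * a)) = ((k - n : ℕ) : ZMod p) * a := by
        rw [Nat.cast_sub (by omega)]
        simp
        ring
      rw [h2]
      exact mul_ne_zero h1 ha
    have hRdeg : R.natDegree ≤ ∑ k ∈ Finset.Ico (n + 1) p, d k := by
      refine (natDegree_prod_le _ _).trans (Finset.sum_le_sum fun k _ => ?_)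
      exact natDegree_pow_le.trans (by rw [natDegree_X_add_C, mul_one])
    have hsum : d n + ∑ k ∈ Finset.Ico (n + 1) p, d k < p := by
      rw [← Finset.sum_eq_sum_Ico_succ_bot (by omega) d]
      refine lt_of_le_of_lt (Finset.sum_le_sum_of_subset ?_) hd
      intro k hk
      exact Finset.mem_range.2 (Finset.mem_Ico.1 hk).2
    obtain ⟨c', hc', hstep⟩ := trialStep_iterate hg ha hh' hRi hc (m := d n) (by omega) (p ^ n)
      (∑ k ∈ Finset.range n, d k * p ^ k) p
    refine ⟨c', h' ^ p, hc', ?_, ?_⟩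
    · have h1 := conj_pow_char hg n
      have h2 : algebraMap (ZMod p) F a ^ p = algebraMap (ZMod p) F a := by
        rw [← map_pow, ZMod.pow_card]
      have h3 : g + ((n + 1 : ℕ) : F) * algebraMap (ZMod p) F a =
          (g + n * algebraMap (ZMod p) F a) ^ p := by
        rw [h1]; push_cast; ring
      rw [h3, ← mul_pow, hh', h2]
    · rw [Finset.prod_eq_prod_Ico_succ_bot (by omega), ← hRval, ← mul_assoc, digitStep]
      dsimp only
      rw [hstep, Nat.sub_eq_zero_of_le (by omega : d n ≤ p), min_eq_right (by omega : d n ≤ p),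
        pow_zero, mul_one, Finset.sum_range_succ, pow_succ]

theorem sum_getD_mul_pow (b : ℕ) {l : List ℕ} {n : ℕ} (hl : l.length ≤ n) :
    ∑ k ∈ Finset.range n, l.getD k 0 * b ^ k = Nat.ofDigits b l := by
  induction l generalizing n with
  | nil => simp
  | cons x l ih =>
    obtain ⟨n, rfl⟩ : ∃ m, n = m + 1 := ⟨n - 1, by simp at hl; omega⟩
    rw [Finset.sum_range_succ', Nat.ofDigits_cons, ← ih (by simpa using hl), Finset.mul_sum,
      add_comm]
    congr 1
    · simp
    · refine Finset.sum_congr rfl fun k _ => ?_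
      rw [List.getD_cons_succ]
      ring

/-- Padding the digit list with zeros to length `p` writes `g ^ e` as a product over all conjugates.
-/
theorem digitStep_iterate_of_digitSum_le (hg : g ^ p = g + algebraMap (ZMod p) F a) (ha : a ≠ 0)
    {h : F} (hh : h * g = algebraMap (ZMod p) F a) {e : ℕ} (he : e < p ^ p)
    (hs : digitSum p e ≤ p - 1) : ((digitStep p)^[p] (g ^ e, h, 0, 1)).2.2.1 = e := by
  have hp2 := hp.out.two_le
  set d : ℕ → ℕ := fun k => (p.digits e).getD k 0 with hd
  have hlen : (p.digits e).length ≤ p := by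
    rwa [Nat.digits_length_le_iff (by omega)]
  have h1 : ∑ k ∈ Finset.range p, d k * p ^ k = e := by
    rw [hd, sum_getD_mul_pow p hlen, Nat.ofDigits_digits]
  have h2 : ∑ k ∈ Finset.range p, d k < p := by
    -- Evaluating the digits at base `1` gives their sum.
    have := sum_getD_mul_pow 1 hlen
    simp only [one_pow, mul_one, Nat.ofDigits_one] at this
    rw [hd, this]
    exact lt_of_le_of_lt hs (by omega)
  have h3 : g ^ e = ∏ k ∈ Finset.range p, (g + k * algebraMap (ZMod p) F a) ^ d k := by
    conv_lhs => rw [← h1]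
    rw [← Finset.prod_pow_eq_pow_sum]
    refine Finset.prod_congr rfl fun k _ => ?_
    rw [← pow_char_pow_eq hg, ← pow_mul, mul_comm]
  obtain ⟨c, h', -, -, hit⟩ := digitStep_iterate hg ha hh h2 le_rfl
  rw [h3, hit]
  exact h1

end ArtinSchreier

namespace RAM

/-! ### The discrete logarithm program

Register `0` holds the base `B` of the encoding, `1` holds `B ^ p`, `2` holds the modulus minus
one, `3`, `4`, `5` hold the generator, the target and the divisor, `6`, `7`, `8` serve the
normalization of codes, `11` holds the logarithm found so far and `12` the current power of `p`. -/

/-- The characteristic, stored in the first input cell. -/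
def charT : Term := .inp (.const 0)

/-- Store in register `6` the normal form of the code in register `8`. -/
def normalizeCmd : Cmd :=
  .seq (.set 6 (.const 0)) <| .seq (.set 7 (.const 1)) <| .rep 0 <|
    .seq (.set 6 (.add (.var 6) (.mul (.mod (.var 8) charT) (.var 7)))) <|
    .seq (.set 8 (.div (.var 8) (.var 0))) <|
    .set 7 (.mod (.mul (.var 7) (.var 0)) (.add (.const 1) (.var 1)))

/-- Store in register `6` the product of the registers `a` and `b`. -/
def mulCmd (a b : ℕ) : Cmd :=
  .seq (.set 8 (.mod (.mul (.var a) (.var b)) (.add (.const 1) (.var 2)))) normalizeCmd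

/-- Raise register `k` to the power `p`. -/
def powCmd (k : ℕ) : Cmd :=
  .seq (.set 16 (.var k)) <| .seq (.rep 1 (.seq (mulCmd 16 k) (.set 16 (.var 6))))
    (.set k (.var 16))

/-- Store in register `6` the sum of the `p ^ j`-th powers, `j < p`, of register `17`. -/
def frobSumCmd : Cmd :=
  .seq (.set 9 (.var 17)) <| .seq (.set 10 (.const 0)) <|
    .seq (.rep 0 (.seq (.set 10 (.add (.var 10) (.var 9))) (powCmd 9))) <|
    .seq (.set 8 (.var 10)) normalizeCmd

/-- Divide the target by a conjugate of the generator if possible. -/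
def trialCmd : Cmd :=
  .seq (mulCmd 4 5) <| .seq (.set 17 (.var 6)) <| .seq frobSumCmd <|
    .ifz (.var 6) (.seq (.set 4 (.var 17)) (.set 11 (.add (.var 11) (.var 12))))

/-- Determine one digit of the logarithm. -/
def digitCmd : Cmd :=
  .seq (.rep 0 trialCmd) <| .seq (powCmd 5) (.set 12 (.mul (.var 12) charT))

/-- Multiply register `k` by `p ^ 3`. -/
def cubeCmd (k : ℕ) : Cmd := .set k (.mul (.var k) (.mul charT (.mul charT charT)))

/-- Compute the base of the encoding and its `p`-th power. -/
def baseCmd : Cmd :=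
  .seq (.set 0 (.const 1)) <| .seq (.rep 0 (cubeCmd 0)) <|
    .seq (.set 1 (.const 1)) (.rep 0 (.rep 0 (cubeCmd 1)))

/-- Compute the inverse of the leading coefficient of the defining polynomial. -/
def invCmd : Cmd :=
  .seq (.set 13 (.const 1))
    (.rep 2 (.set 13 (.mod (.mul (.var 13) (.inp (.add charT (.const 1)))) charT)))

/-- One step of `loadCmd`. -/
def loadStep : Cmd :=
  .seq (.set 14 (.add (.var 14)
    (.mul (.mod (.mul (.sub charT (.inp (.add (.const 1) (.var 15)))) (.var 13)) charT)
      (.var 7)))) <|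
  .seq (.set 3 (.add (.var 3)
    (.mul (.inp (.add (.add charT (.const 2)) (.var 15))) (.var 7)))) <|
  .seq (.set 4 (.add (.var 4)
    (.mul (.inp (.add (.add (.add charT charT) (.const 2)) (.var 15))) (.var 7)))) <|
  .seq (.set 7 (.mod (.mul (.var 7) (.var 0)) (.add (.const 1) (.var 1)))) <|
  .set 15 (.add (.var 15) (.const 1))

/-- Encode the defining polynomial, the generator and the target. -/
def loadCmd : Cmd :=
  .seq (.set 14 (.const 0)) <| .seq (.set 3 (.const 0)) <| .seq (.set 4 (.const 0)) <|
    .seq (.set 7 (.const 1)) <| .seq (.set 15 (.const 0)) <| .seq (.rep 0 loadStep) <|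
    .set 2 (.sub (.sub (.var 1) (.var 14)) (.const 1))

/-- Compute the first divisor `g ^ (p - 1) - 1` and initialize the logarithm. -/
def divisorCmd : Cmd :=
  .seq (.set 5 (.const 1)) <| .seq (.rep 1 (.seq (mulCmd 5 3) (.set 5 (.var 6)))) <|
    .seq (.set 8 (.add (.var 5) (.sub charT (.const 1)))) <| .seq normalizeCmd <|
    .seq (.set 5 (.var 6)) <| .seq (.set 11 (.const 0)) (.set 12 (.const 1))

/-- The discrete logarithm program; its result is in register `11`. -/
def dlogCmd : Cmd :=
  .seq baseCmd <| .seq invCmd <| .seq loadCmd <| .seq divisorCmd (.rep 0 digitCmd)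

theorem val_charT (I σ : Mem) : charT.val I σ = I 0 := by simp [charT, Term.val]

theorem tame_dlogCmd {I : Mem} (h2 : 2 ≤ I 0) (hI : ∀ i, I i ≤ I 0) : dlogCmd.Tame I := by
  -- As `p ≥ 2`, the factor `p ^ 3` exceeds `p + 1`, which covers all sums that occur; `cubeCmd`
  -- uses the factor in full.
  have hcube : ∀ N, N * (I 0 + 1) ≤ N * I 0 ^ 3 := fun N => Nat.mul_le_mul_left _ (by
    have : I 0 * 2 * 2 ≤ I 0 ^ 3 := by rw [pow_three, ← mul_assoc]; gcongr
    omega)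
  have hdouble : ∀ N, N + N ≤ N * I 0 ^ 3 := fun N => by nlinarith [hcube N]
  have hpos : ∀ N, N ≤ N * I 0 ^ 3 := fun N => by nlinarith [hcube N]
  have hchar : ∀ N, N * I 0 ≤ N * I 0 ^ 3 := fun N => by nlinarith [hcube N]
  have hadd : ∀ {N x y z : ℕ}, x ≤ N → y ≤ I 0 → z ≤ N → x + y * z ≤ N * I 0 ^ 3 := by
    intro N x y z hx hy hz
    have := hcube N
    have := Nat.mul_le_mul hy hz
    nlinarith
  have hmod : ∀ x y : ℕ, x % (1 + y) ≤ y := fun x y => by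
    have := Nat.mod_lt x (show 0 < 1 + y by omega)
    omega
  have hmodp : ∀ x : ℕ, x % I 0 ≤ I 0 := fun x => (Nat.mod_lt _ (by omega)).le
  simp only [dlogCmd, baseCmd, invCmd, loadCmd, loadStep, divisorCmd, digitCmd, trialCmd,
    frobSumCmd, powCmd, mulCmd, normalizeCmd, cubeCmd, Cmd.Tame, Term.val, val_charT]
  have hpow : I 0 * (I 0 * I 0) ≤ I 0 ^ 3 := (pow_three _).ge
  repeat' apply And.intro
  all_goals
    intro σ N hN hσ
    first
    | exact Nat.zero_le _
    | exact (by omega : 1 ≤ N).trans (hpos N)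
    | exact (hσ _).trans (hpos N)
    | exact (Nat.div_le_self _ _).trans ((hσ _).trans (hpos N))
    | exact (hmod _ _).trans ((hσ _).trans (hpos N))
    | exact hadd (hσ _) (hmodp _) (hσ _)
    | exact hadd (hσ _) (hI _) (hσ _)
    | exact (hmodp _).trans (hN.trans (hpos N))
    | exact Nat.mul_le_mul (hσ _) hpow
    | exact (Nat.mul_le_mul_right _ (hσ _)).trans (hchar N)
    | exact (Nat.add_le_add (hσ _) (hσ _)).trans (hdouble N)
    | exact (Nat.add_le_add (hσ _) (by omega)).trans (hdouble N)
    | exact ((Nat.sub_le _ _).trans (Nat.sub_le _ _)).trans ((hσ _).trans (hpos N))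

theorem iterate_induction {α : Type*} {f : α → α} {P : ℕ → α → Prop} {x : α} {n : ℕ} (h0 : P 0 x)
    (hs : ∀ j < n, ∀ y, P j y → P (j + 1) (f y)) : P n (f^[n] x) := by
  induction n with
  | zero => exact h0
  | succ n ih =>
    rw [Function.iterate_succ_apply']
    exact hs n (by omega) _ (ih fun j hj => hs j (by omega))

/-! ### Correctness of the subroutines on encoded field elements. -/

section Correctness

variable {I : Mem} {p B : ℕ}

theorem run_normalizeCmd (hp : I 0 = p) (hB : 1 ≤ B) {σ : Mem} (h0 : σ 0 = B) (h1 : σ 1 = B ^ p) :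
    normalizeCmd.run I σ 6 = ∑ i ∈ Finset.range p, σ 8 / B ^ i % p * B ^ i := by
  simp only [normalizeCmd, Cmd.run, hp, Nat.sub_zero, Term.val, val_charT]
  refine (iterate_induction (P := fun j (τ : Mem) => τ 0 = B ∧ τ 1 = B ^ p ∧ τ 7 = B ^ j ∧
    τ 8 = σ 8 / B ^ j ∧ τ 6 = ∑ i ∈ Finset.range j, σ 8 / B ^ i % p * B ^ i) ?_ ?_).2.2.2.2
  · simp [h0, h1]
  · rintro j hj τ ⟨e0, e1, e7, e8, e6⟩
    -- The remainder modulo `1 + B ^ p` never changes the power of `B`; it only makes the growth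
    -- bound of the assignment evident.
    have h3 : B ^ (j + 1) < 1 + B ^ p := by
      have := Nat.pow_le_pow_right hB (show j + 1 ≤ p by omega)
      omega
    simp [e0, e1, e7, e8, e6, Finset.sum_range_succ, Nat.div_div_eq_div_mul, ← pow_succ,
      Nat.mod_eq_of_lt h3]

variable {F : Type*} [Field F]

/-- The registers `0`, `1`, `2` hold the parameters of the encoding. -/
structure Ready (B p U : ℕ) (σ : Mem) : Prop where
  base : σ 0 = B
  pow : σ 1 = B ^ p
  modulus : 1 + σ 2 = U

/-- Encoded elements of `F` can be multiplied modulo `U` and compared with zero. -/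
structure Coding (p B U : ℕ) (Y : F) : Prop where
  two_le : 2 ≤ p
  dvd : p ∣ B
  lt : p ^ (p + 3) + p ≤ B
  mul {n m : ℕ} {x y : F} : Enc p B Y (p - 1) n x → Enc p B Y (p - 1) m y →
    Enc p B Y (p ^ (p + 3)) (n * m % U) (x * y)
  zero {n : ℕ} {x : F} : Enc p B Y (p - 1) n x → (n = 0 ↔ x = 0)

variable {U : ℕ} {Y : F}

theorem Ready.run {σ : Mem} (h : Ready B p U σ) (A : Cmd) (hA : ∀ k < 3, k ∉ A.writes) :
    Ready B p U (A.run I σ) :=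
  ⟨by rw [Cmd.run_of_notMem _ _ _ (hA 0 (by simp))]; exact h.base,
    by rw [Cmd.run_of_notMem _ _ _ (hA 1 (by simp))]; exact h.pow,
    by rw [Cmd.run_of_notMem _ _ _ (hA 2 (by simp))]; exact h.modulus⟩

theorem Ready.update {σ : Mem} (h : Ready B p U σ) {k : ℕ} (hk : 3 ≤ k) (v : ℕ) :
    Ready B p U (Function.update σ k v) :=
  ⟨by rw [Function.update_of_ne (by omega)]; exact h.base,
    by rw [Function.update_of_ne (by omega)]; exact h.pow,
    by rw [Function.update_of_ne (by omega)]; exact h.modulus⟩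

variable [CharP F p]

theorem enc_normalizeCmd (hp : I 0 = p) (hc : Coding p B U Y) {σ : Mem} (hσ : Ready B p U σ)
    {K : ℕ} {x : F} (hK : K < B) (h : Enc p B Y K (σ 8) x) :
    Enc p B Y (p - 1) (normalizeCmd.run I σ 6) x := by
  have h1 := hc.two_le
  have h2 := hc.lt
  rw [run_normalizeCmd hp (by omega) hσ.base hσ.pow]
  exact h.normalize (by omega) hc.dvd hK

theorem run_mulCmd_of_notMem {a b k : ℕ} (σ : Mem) (hk : k ∉ [6, 7, 8]) :
    (mulCmd a b).run I σ k = σ k :=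
  Cmd.run_of_notMem _ _ _ (by
    simp [mulCmd, normalizeCmd, Cmd.writes] at hk ⊢; omega)

theorem Ready.mulCmd {σ : Mem} (h : Ready B p U σ) (a b : ℕ) :
    Ready B p U ((mulCmd a b).run I σ) :=
  h.run _ fun k hk => by simp [RAM.mulCmd, normalizeCmd, Cmd.writes]; omega

theorem enc_mulCmd (hp : I 0 = p) (hc : Coding p B U Y) {σ : Mem} (hσ : Ready B p U σ) {a b : ℕ}
    {x y : F} (ha : Enc p B Y (p - 1) (σ a) x) (hb : Enc p B Y (p - 1) (σ b) y) :
    Enc p B Y (p - 1) ((mulCmd a b).run I σ 6) (x * y) := by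
  have h1 := hc.two_le
  have h2 := hc.lt
  refine enc_normalizeCmd hp hc (hσ.update (k := 8) (by norm_num) _) (K := p ^ (p + 3)) (by omega) ?_
  simp only [Function.update_self, Term.val, hσ.modulus]
  exact hc.mul ha hb

theorem run_powCmd_of_notMem {j k : ℕ} (σ : Mem) (hk : k ∉ [6, 7, 8, 16, j]) :
    (powCmd j).run I σ k = σ k :=
  Cmd.run_of_notMem _ _ _ (by
    simp [powCmd, mulCmd, normalizeCmd, Cmd.writes] at hk ⊢; omega)

theorem Ready.powCmd {σ : Mem} (h : Ready B p U σ) {j : ℕ} (hj : 3 ≤ j) :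
    Ready B p U ((powCmd j).run I σ) :=
  h.run _ fun k hk => by simp [RAM.powCmd, RAM.mulCmd, normalizeCmd, Cmd.writes]; omega

theorem enc_powCmd (hp : I 0 = p) (hc : Coding p B U Y) {σ : Mem} (hσ : Ready B p U σ) {k : ℕ}
    {x : F} (hk : k ∉ [6, 7, 8, 16]) (h : Enc p B Y (p - 1) (σ k) x) :
    Enc p B Y (p - 1) ((powCmd k).run I σ k) (x ^ p) := by
  have h1 := hc.two_le
  have hk' : k ≠ 16 ∧ k ∉ [6, 7, 8] := by simp at hk ⊢; omega
  simp only [powCmd, Cmd.run, hp, Function.update_self, Term.val]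
  -- The accumulator starts at `x`, so `p - 1` multiplications give `x ^ p`.
  have := (iterate_induction (n := p - 1) (f := fun τ : Mem =>
      Function.update ((mulCmd 16 k).run I τ) 16 ((mulCmd 16 k).run I τ 6))
    (x := Function.update σ 16 (σ k))
    (P := fun j (τ : Mem) => Ready B p U τ ∧ τ k = σ k ∧ Enc p B Y (p - 1) (τ 16) (x ^ (j + 1)))
    ⟨hσ.update (by norm_num) _, by simp [hk'.1], by simpa using h⟩ ?_).2.2
  · rwa [show p - 1 + 1 = p by omega] at this
  · rintro j - τ ⟨hτ, hτk, hτ'⟩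
    refine ⟨(hτ.mulCmd 16 k).update (by norm_num) _, ?_, ?_⟩
    · rw [Function.update_of_ne hk'.1, run_mulCmd_of_notMem _ hk'.2, hτk]
    · rw [Function.update_self, pow_succ]
      exact enc_mulCmd hp hc hτ hτ' (by rwa [hτk])

theorem run_frobSumCmd_of_notMem {k : ℕ} (σ : Mem) (hk : k ∉ [6, 7, 8, 9, 10, 16]) :
    frobSumCmd.run I σ k = σ k :=
  Cmd.run_of_notMem _ _ _ (by
    simp [frobSumCmd, powCmd, mulCmd, normalizeCmd, Cmd.writes] at hk ⊢; omega)

theorem enc_frobSumCmd (hp : I 0 = p) (hc : Coding p B U Y) {σ : Mem} (hσ : Ready B p U σ)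
    {x : F} (h : Enc p B Y (p - 1) (σ 17) x) :
    Enc p B Y (p - 1) (frobSumCmd.run I σ 6) (frobSum p x) := by
  have h1 := hc.two_le
  have h2 := hc.lt
  -- A sum of `p` normalized codes still has digits below `B`, so one normalization after the loop
  -- suffices.
  have hK : p * (p - 1) < B := by
    have h3 : p * (p - 1) ≤ p ^ (p + 3) := by
      calc p * (p - 1) ≤ p * p ^ (p + 2) :=
            Nat.mul_le_mul_left _ ((Nat.sub_le _ _).trans (Nat.le_self_pow (by omega) _))
        _ = _ := by ring
    omega
  simp only [frobSumCmd, Cmd.run, hp, Term.val, Nat.sub_zero]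
  obtain ⟨e1, -, e3⟩ := iterate_induction (n := p) (f := fun τ : Mem =>
      (powCmd 9).run I (Function.update τ 10 (τ 10 + τ 9)))
    (x := Function.update (Function.update σ 9 (σ 17)) 10 0)
    (P := fun j (τ : Mem) => Ready B p U τ ∧ Enc p B Y (p - 1) (τ 9) (x ^ p ^ j) ∧
      Enc p B Y (j * (p - 1)) (τ 10) (∑ i ∈ Finset.range j, x ^ p ^ i))
    ⟨(hσ.update (by norm_num) _).update (by norm_num) _, by simpa using h,
      by simpa using Enc.zero⟩ (by
    rintro j - τ ⟨hτ, hτ9, hτ10⟩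
    have hr := hτ.update (k := 10) (by norm_num) (τ 10 + τ 9)
    refine ⟨hr.powCmd (by norm_num), ?_, ?_⟩
    · rw [pow_succ, pow_mul]
      exact enc_powCmd hp hc hr (by decide) (by simpa using hτ9)
    · rw [run_powCmd_of_notMem _ (by decide), Function.update_self, Finset.sum_range_succ,
        add_mul, one_mul]
      exact hτ10.add hτ9)
  refine enc_normalizeCmd hp hc (e1.update (k := 8) (by norm_num) _) hK ?_
  rw [Function.update_self]
  exact e3

/-- The registers hold the state of the determination of the digits. -/
structure Tracks (p B U : ℕ) (Y : F) (σ : Mem) (s : F × F × ℕ × ℕ) : Prop where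
  ready : Ready B p U σ
  target : Enc p B Y (p - 1) (σ 4) s.1
  divisor : Enc p B Y (p - 1) (σ 5) s.2.1
  log : σ 11 = s.2.2.1
  power : σ 12 = s.2.2.2

/-- The zero test on the register agrees with the test in `F` because a normalized code is zero only
for the element zero. -/
theorem Tracks.trialCmd (hp : I 0 = p) (hc : Coding p B U Y) {σ : Mem} {w h : F} {e P : ℕ}
    (hσ : Tracks p B U Y σ (w, h, e, P)) :
    Tracks p B U Y (trialCmd.run I σ)
      ((trialStep p h P (w, e)).1, h, (trialStep p h P (w, e)).2, P) := by
  obtain ⟨hr, h4, h5, h11, h12⟩ := hσ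
  dsimp only at h4 h5 h11 h12
  have hm := enc_mulCmd hp hc hr h4 h5
  have hr1 := hr.mulCmd (I := I) 4 5
  set τ := Function.update ((mulCmd 4 5).run I σ) 17 ((mulCmd 4 5).run I σ 6) with hτ
  have hrτ : Ready B p U τ := hr1.update (by norm_num) _
  have hτ17 : Enc p B Y (p - 1) (τ 17) (w * h) := by rw [hτ, Function.update_self]; exact hm
  have hkeep : ∀ k, k ∉ [6, 7, 8, 9, 10, 16, 17] → frobSumCmd.run I τ k = σ k := by
    intro k hk
    rw [run_frobSumCmd_of_notMem _ (by simp at hk ⊢; omega), hτ,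
      Function.update_of_ne (by simp at hk; omega),
      run_mulCmd_of_notMem _ (by simp at hk ⊢; omega)]
  have hkeep17 : frobSumCmd.run I τ 17 = τ 17 := run_frobSumCmd_of_notMem _ (by decide)
  have hrf : Ready B p U (frobSumCmd.run I τ) :=
    ⟨by rw [hkeep 0 (by decide)]; exact hr.base, by rw [hkeep 1 (by decide)]; exact hr.pow,
      by rw [hkeep 2 (by decide)]; exact hr.modulus⟩
  have hiff := hc.zero (enc_frobSumCmd hp hc hrτ hτ17)
  set ρ := frobSumCmd.run I τ with hρ
  have hrun : RAM.trialCmd.run I σ = if ρ 6 = 0 then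
      Function.update (Function.update ρ 4 (ρ 17)) 11
        (Function.update ρ 4 (ρ 17) 11 + Function.update ρ 4 (ρ 17) 12) else ρ := rfl
  rw [hrun]
  by_cases h0 : frobSum p (w * h) = 0
  · rw [if_pos (hiff.2 h0), trialStep, if_pos h0]
    refine ⟨(hrf.update (by norm_num) _).update (by norm_num) _, ?_, ?_, ?_, ?_⟩
    · simpa [hkeep17] using hτ17
    · simpa [hkeep 5 (by decide)] using h5
    · simp [hkeep 11 (by decide), hkeep 12 (by decide), h11, h12]
    · simp [hkeep 12 (by decide), h12]
  · rw [if_neg (mt hiff.1 h0), trialStep, if_neg h0]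
    exact ⟨hrf, by simpa [hkeep 4 (by decide)] using h4, by simpa [hkeep 5 (by decide)] using h5,
      by simp [hkeep 11 (by decide), h11], by simp [hkeep 12 (by decide), h12]⟩

theorem Tracks.digitCmd (hp : I 0 = p) (hc : Coding p B U Y) {σ : Mem} {s : F × F × ℕ × ℕ}
    (hσ : Tracks p B U Y σ s) : Tracks p B U Y (digitCmd.run I σ) (digitStep p s) := by
  obtain ⟨w, h, e, P⟩ := s
  simp only [RAM.digitCmd, Cmd.run, hp, Nat.sub_zero, Term.val, val_charT, digitStep]
  obtain ⟨hr, h4, h5, h11, h12⟩ := iterate_induction (n := p) (f := RAM.trialCmd.run I) (x := σ)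
    (P := fun j (τ : Mem) => Tracks p B U Y τ
      (((trialStep p h P)^[j] (w, e)).1, h, ((trialStep p h P)^[j] (w, e)).2, P)) hσ (by
    intro j _ τ hτ
    rw [Function.iterate_succ_apply']
    exact hτ.trialCmd hp hc)
  dsimp only at h4 h5 h11 h12
  set τ := (RAM.trialCmd.run I)^[p] σ
  refine ⟨(hr.powCmd (by norm_num)).update (by norm_num) _, ?_, ?_, ?_, ?_⟩
  · rw [Function.update_of_ne (by norm_num), run_powCmd_of_notMem _ (by decide)]
    exact h4
  · rw [Function.update_of_ne (by norm_num)]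
    exact enc_powCmd hp hc hr (by decide) h5
  · rw [Function.update_of_ne (by norm_num), run_powCmd_of_notMem _ (by decide)]
    exact h11
  · rw [Function.update_self, run_powCmd_of_notMem _ (by decide), h12]

theorem tracks_divisorCmd (hp : I 0 = p) (hc : Coding p B U Y) {σ : Mem} (hσ : Ready B p U σ)
    {g w : F} (hg : Enc p B Y (p - 1) (σ 3) g) (hw : Enc p B Y (p - 1) (σ 4) w) :
    Tracks p B U Y (divisorCmd.run I σ) (w, g ^ (p - 1) - 1, 0, 1) := by
  have h1 := hc.two_le
  have h2 := hc.lt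
  have hone := (Enc.natCast (B := B) (Y := Y) (show 1 ≤ p by omega) 1).mono
    (show 1 ≤ p - 1 by omega)
  simp only [divisorCmd, Cmd.run, hp, Term.val, val_charT]
  obtain ⟨e1, e3, e4, e5⟩ := iterate_induction (n := p - 1) (f := fun τ : Mem =>
      Function.update ((mulCmd 5 3).run I τ) 5 ((mulCmd 5 3).run I τ 6))
    (x := Function.update σ 5 1)
    (P := fun j (τ : Mem) => Ready B p U τ ∧ τ 3 = σ 3 ∧ τ 4 = σ 4 ∧
      Enc p B Y (p - 1) (τ 5) (g ^ j))
    ⟨hσ.update (by norm_num) _, by simp, by simp, by simpa using hone⟩ (by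
    rintro j - τ ⟨hτ, hτ3, hτ4, hτ5⟩
    refine ⟨(hτ.mulCmd 5 3).update (by norm_num) _, ?_, ?_, ?_⟩
    · rw [Function.update_of_ne (by norm_num), run_mulCmd_of_notMem _ (by decide), hτ3]
    · rw [Function.update_of_ne (by norm_num), run_mulCmd_of_notMem _ (by decide), hτ4]
    · rw [Function.update_self, pow_succ]
      exact enc_mulCmd hp hc hτ hτ5 (by rwa [hτ3]))
  set τ := (fun τ : Mem =>
    Function.update ((mulCmd 5 3).run I τ) 5 ((mulCmd 5 3).run I τ 6))^[p - 1]
      (Function.update σ 5 1)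
  set τ' := Function.update τ 8 (τ 5 + (p - 1)) with hτ'
  have hr' : Ready B p U τ' := e1.update (by norm_num) _
  have hkeep : ∀ k, k ∉ [6, 7, 8] → normalizeCmd.run I τ' k = τ k := by
    intro k hk
    rw [Cmd.run_of_notMem _ _ _ (by simp [normalizeCmd, Cmd.writes] at hk ⊢; omega), hτ',
      Function.update_of_ne (by simp at hk; omega)]
  have hr : Ready B p U (normalizeCmd.run I τ') :=
    hr'.run _ fun k hk => by simp [normalizeCmd, Cmd.writes]; omega
  have h8 : Enc p B Y (p - 1) (normalizeCmd.run I τ' 6) (g ^ (p - 1) - 1) := by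
    have hK : p - 1 + (p - 1) < B := by
      have : p ≤ p ^ (p + 3) := Nat.le_self_pow (by omega) _
      omega
    refine enc_normalizeCmd hp hc hr' hK ?_
    rw [hτ', Function.update_self, sub_eq_add_neg]
    -- Subtracting one is done by adding `p - 1` to the code, which keeps digits nonnegative.
    have h3 : ((p - 1 : ℕ) : F) = -1 := by
      rw [Nat.cast_sub (by omega), CharP.cast_eq_zero]; simp
    rw [← h3]
    exact e5.add (Enc.natCast (by omega) _)
  refine ⟨((hr.update (by norm_num) _).update (by norm_num) _).update (by norm_num) _, ?_, ?_,
    by simp, by simp⟩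
  · simpa [hkeep 4 (by decide), e4] using hw
  · simpa using h8

end Correctness

end RAM

namespace RAM

/-! ### Setting up the base, the modulus and the codes of the input. -/

section Load

variable {I : Mem} {p B : ℕ}

theorem run_baseCmd (hp : I 0 = p) (σ : Mem) :
    baseCmd.run I σ 0 = p ^ (3 * p) ∧ baseCmd.run I σ 1 = (p ^ (3 * p)) ^ p := by
  simp only [baseCmd, cubeCmd, Cmd.run, hp, Nat.sub_zero, Term.val, val_charT]
  have h0 := iterate_induction (n := p) (f := fun τ : Mem =>
      Function.update τ 0 (τ 0 * (p * (p * p)))) (x := Function.update σ 0 1)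
    (P := fun j (τ : Mem) => τ 0 = p ^ (3 * j)) (by simp) (by
    intro j _ τ hτ
    rw [Function.update_self, hτ]
    ring)
  set τ := (fun τ : Mem => Function.update τ 0 (τ 0 * (p * (p * p))))^[p] (Function.update σ 0 1)
  have hin : ∀ (τ : Mem) (n : ℕ), ((fun τ : Mem => Function.update τ 1 (τ 1 * (p * (p * p))))^[n] τ) 0
      = τ 0 ∧ ((fun τ : Mem => Function.update τ 1 (τ 1 * (p * (p * p))))^[n] τ) 1 =
        τ 1 * p ^ (3 * n) := by
    intro τ n
    refine iterate_induction (P := fun j (ρ : Mem) => ρ 0 = τ 0 ∧ ρ 1 = τ 1 * p ^ (3 * j))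
      (by simp) ?_
    rintro j - ρ ⟨e0, e1⟩
    refine ⟨by simp [e0], ?_⟩
    rw [Function.update_self, e1]
    ring
  refine iterate_induction (P := fun j (ρ : Mem) => ρ 0 = p ^ (3 * p) ∧
    ρ 1 = (p ^ (3 * p)) ^ j) (by simp [h0]) ?_
  rintro j - ρ ⟨e0, e1⟩
  rw [(hin ρ p).1, (hin ρ p).2, e0, e1, pow_succ]
  exact ⟨rfl, rfl⟩

/-- By Fermat, the power `p - 2` inverts the leading coefficient of `u`, which sits in cell `p + 1`.
-/
theorem run_invCmd (hp : I 0 = p) (h2 : 2 ≤ p) (σ : Mem) :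
    ((invCmd.run I σ 13 : ℕ) : ZMod p) = (I (p + 1) : ZMod p) ^ (p - 2) := by
  simp only [invCmd, Cmd.run, hp, Term.val, val_charT]
  refine iterate_induction (P := fun j (τ : Mem) => ((τ 13 : ℕ) : ZMod p) = (I (p + 1) : ZMod p) ^ j)
    (by simp) ?_
  intro j _ τ hτ
  rw [Function.update_self, ZMod.natCast_mod, Nat.cast_mul, hτ, pow_succ,
    Nat.mod_eq_of_lt (by omega)]

theorem run_loadCmd (hp : I 0 = p) {σ : Mem} (hpB : p ≤ B) (h2 : 2 ≤ p) (h0 : σ 0 = B)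
    (h1 : σ 1 = B ^ p) :
    Ready B p (B ^ p - ∑ i ∈ Finset.range p, (p - I (1 + i)) * σ 13 % p * B ^ i)
      (loadCmd.run I σ) ∧
    loadCmd.run I σ 3 = ∑ i ∈ Finset.range p, I (p + 2 + i) * B ^ i ∧
    loadCmd.run I σ 4 = ∑ i ∈ Finset.range p, I (p + p + 2 + i) * B ^ i := by
  have hlt : ∑ i ∈ Finset.range p, (p - I (1 + i)) * σ 13 % p * B ^ i < B ^ p :=
    sum_mul_pow_lt (fun i => (Nat.mod_lt _ (by omega)).trans_le hpB) p
  simp only [loadCmd, Cmd.run, hp, Nat.sub_zero, Term.val]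
  obtain ⟨e0, e1, -, e3, e4, -, -, e14⟩ := iterate_induction (n := p) (f := loadStep.run I)
    (x := Function.update (Function.update (Function.update (Function.update
      (Function.update σ 14 0) 3 0) 4 0) 7 1) 15 0)
    (P := fun j (τ : Mem) => τ 0 = B ∧ τ 1 = B ^ p ∧ τ 13 = σ 13 ∧
      τ 3 = ∑ i ∈ Finset.range j, I (p + 2 + i) * B ^ i ∧
      τ 4 = ∑ i ∈ Finset.range j, I (p + p + 2 + i) * B ^ i ∧
      τ 7 = B ^ j ∧ τ 15 = j ∧
      τ 14 = ∑ i ∈ Finset.range j, (p - I (1 + i)) * σ 13 % p * B ^ i)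
    (by simp [h0, h1]) (by
    rintro j hj τ ⟨e0, e1, e13, e3, e4, e7, e15, e14⟩
    -- All addresses read lie inside the input block, so the wraparound of `inp` has no effect.
    have m1 : (1 + j) % (3 * p + 2) = 1 + j := Nat.mod_eq_of_lt (by omega)
    have m2 : (p + 2 + j) % (3 * p + 2) = p + 2 + j := Nat.mod_eq_of_lt (by omega)
    have m3 : (p + p + 2 + j) % (3 * p + 2) = p + p + 2 + j := Nat.mod_eq_of_lt (by omega)
    have m4 : B ^ (j + 1) % (1 + B ^ p) = B ^ (j + 1) := by
      refine Nat.mod_eq_of_lt ?_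
      have := Nat.pow_le_pow_right (show 0 < B by omega) (show j + 1 ≤ p by omega)
      omega
    simp [loadStep, Cmd.run, Term.val, val_charT, hp, e0, e1, e13, e3, e4, e7, e15, e14, m1, m2, m3,
      ← pow_succ, m4, Finset.sum_range_succ])
  refine ⟨⟨?_, ?_, ?_⟩, ?_, ?_⟩
  · simpa using e0
  · simpa using e1
  -- By `hlt` the truncated subtractions are exact, so the register holds the modulus minus one.
  · rw [Function.update_self, e1, e14]
    omega
  · simpa using e3
  · simpa using e4

theorem frame_invCmd {k : ℕ} (σ : Mem) (hk : k ≠ 13) : invCmd.run I σ k = σ k :=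
  Cmd.run_of_notMem _ _ _ (by simpa [invCmd, Cmd.writes] using hk)

end Load

/-! ### Positions and size of the entries of the input list. -/

section Input

variable (p : ℕ) (u v w : (ZMod p)[X])

theorem length_dlogInput : (dlogInput p u v w).length = 3 * p + 2 := by
  simp [dlogInput, coeffVals]
  ring

theorem init_dlogInput_zero : init (dlogInput p u v w) 0 = p := rfl

theorem init_dlogInput_modulus {i : ℕ} (hi : i ≤ p) :
    init (dlogInput p u v w) (1 + i) = (u.coeff i).val := by
  have h1 : i < p + 1 := by omega
  rw [add_comm]
  simp [init, dlogInput, coeffVals, List.getElem?_append, h1]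

theorem init_dlogInput_base {i : ℕ} (hi : i < p) :
    init (dlogInput p u v w) (p + 2 + i) = (v.coeff i).val := by
  rw [show p + 2 + i = (p + 1 + i) + 1 by ring]
  simp [init, dlogInput, coeffVals, List.getElem?_append, hi, show ¬ p + 1 + i ≤ p by omega]

theorem init_dlogInput_target {i : ℕ} (hi : i < p) :
    init (dlogInput p u v w) (p + p + 2 + i) = (w.coeff i).val := by
  rw [show p + p + 2 + i = (p + 1 + p + i) + 1 by ring]
  have h2 : p + 1 + p + i - (p + 1) - p = i := by omega
  simp [init, dlogInput, coeffVals, List.getElem?_append, hi, h2,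
    show ¬ p + 1 + p + i ≤ p by omega, show ¬ p + 1 + p + i - (p + 1) < p by omega]

theorem le_of_mem_dlogInput [NeZero p] {x : ℕ} (hx : x ∈ dlogInput p u v w) : x ≤ p := by
  simp only [dlogInput, coeffVals, List.mem_cons, List.mem_append, List.mem_map] at hx
  rcases hx with rfl | (⟨i, -, rfl⟩ | ⟨i, -, rfl⟩) | ⟨i, -, rfl⟩
  · exact le_rfl
  all_goals exact (ZMod.val_lt _).le

end Input

/-! ### The program in the field `𝔽_p[y]/(u)`. -/

section AdjoinRoot

open Polynomial

variable {p : ℕ} [hp : Fact p.Prime] {u : (ZMod p)[X]} [hu : Fact (Irreducible u)]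

theorem sum_val_mul_root_pow {n : ℕ} {v : (ZMod p)[X]} (hv : v.natDegree < n) :
    ∑ i ∈ Finset.range n, ((v.coeff i).val : AdjoinRoot u) * AdjoinRoot.root u ^ i =
      AdjoinRoot.mk u v := by
  rw [← AdjoinRoot.aeval_eq, aeval_eq_sum_range' hv]
  refine Finset.sum_congr rfl fun i _ => ?_
  rw [Algebra.smul_def, ← map_natCast (algebraMap (ZMod p) (AdjoinRoot u)), ZMod.natCast_zmod_val]

theorem dvd_of_sum_root_pow_eq_zero (hdeg : u.natDegree = p) (f : ℕ → ℕ)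
    (h : ∑ i ∈ Finset.range p, (f i : AdjoinRoot u) * AdjoinRoot.root u ^ i = 0) (i : ℕ)
    (hi : i < p) : p ∣ f i := by
  set P : (ZMod p)[X] := ∑ i ∈ Finset.range p, C (f i : ZMod p) * X ^ i with hP
  have hmk : AdjoinRoot.mk u P = 0 := by
    rw [← h, hP, map_sum]
    refine Finset.sum_congr rfl fun i _ => ?_
    simp
  have hPdeg : P.degree < u.degree := by
    rw [degree_eq_natDegree hu.out.ne_zero, hdeg]
    refine lt_of_le_of_lt (degree_sum_le _ _) ?_
    rw [Finset.sup_lt_iff (WithBot.bot_lt_coe _)]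
    intro j hj
    refine (degree_C_mul_X_pow_le _ _).trans_lt ?_
    exact_mod_cast Finset.mem_range.1 hj
  have hP0 : P = 0 := eq_zero_of_dvd_of_degree_lt (AdjoinRoot.mk_eq_zero.1 hmk) hPdeg
  have hcoeff : P.coeff i = (f i : ZMod p) := by
    simp [hP, finsetSum_coeff, coeff_X_pow, hi]
  rw [← ZMod.natCast_eq_zero_iff, ← hcoeff, hP0, coeff_zero]

/-- Here `m` represents the inverse of the leading coefficient, so the `c i` are the negated lower
coefficients of the monic multiple of `u`. -/
theorem root_pow_eq (hdeg : u.natDegree = p) {c : ℕ → ℕ} {m : ℕ}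
    (hm : (m : ZMod p) = u.coeff p ^ (p - 2))
    (hc : ∀ i < p, (c i : ZMod p) = -u.coeff i * m) :
    AdjoinRoot.root u ^ p = ∑ i ∈ Finset.range p, (c i : AdjoinRoot u) * AdjoinRoot.root u ^ i := by
  have h2 := hp.out.two_le
  have hlead : u.coeff p ≠ 0 := by
    have := leadingCoeff_ne_zero.2 hu.out.ne_zero
    rwa [leadingCoeff, hdeg] at this
  have hinv : u.coeff p * m = 1 := by
    rw [hm, ← pow_succ', show p - 2 + 1 = p - 1 by omega, ZMod.pow_card_sub_one_eq_one hlead]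
  have h0 : aeval (AdjoinRoot.root u) u = 0 := by rw [AdjoinRoot.aeval_eq, AdjoinRoot.mk_self]
  rw [aeval_eq_sum_range, hdeg, Finset.sum_range_succ] at h0
  have h1 : ∀ i ∈ Finset.range p, (c i : AdjoinRoot u) * AdjoinRoot.root u ^ i =
      -algebraMap (ZMod p) (AdjoinRoot u) m * (u.coeff i • AdjoinRoot.root u ^ i) := by
    intro i hi
    rw [← map_natCast (algebraMap (ZMod p) (AdjoinRoot u)), hc i (Finset.mem_range.1 hi),
      Algebra.smul_def, map_mul, map_neg]
    ring
  rw [Finset.sum_congr rfl h1, ← Finset.mul_sum, eq_neg_of_add_eq_zero_left h0, Algebra.smul_def]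
  have h3 := congrArg (algebraMap (ZMod p) (AdjoinRoot u)) hinv
  rw [map_mul, map_one] at h3
  linear_combination (-AdjoinRoot.root u ^ p) * h3

theorem run_dlogCmd (hdeg : u.natDegree = p) {g : AdjoinRoot u} {a : ZMod p} (ha : a ≠ 0)
    (hg : g ^ p = g + algebraMap (ZMod p) (AdjoinRoot u) a) {v w : (ZMod p)[X]}
    (hv : v.natDegree < p) (hw : w.natDegree < p) {e : ℕ} (he : e < p ^ p)
    (hs : digitSum p e ≤ p - 1) (hvg : AdjoinRoot.mk u v = g) (hwg : AdjoinRoot.mk u w = g ^ e) :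
    dlogCmd.run (init (dlogInput p u v w)) 0 11 = e := by
  have : CharP (AdjoinRoot u) p :=
    charP_of_injective_algebraMap (algebraMap (ZMod p) (AdjoinRoot u)).injective p
  have h2 := hp.out.two_le
  set I := init (dlogInput p u v w) with hI
  have hp0 : I 0 = p := rfl
  simp only [dlogCmd, Cmd.run, hp0, Nat.sub_zero]
  set σ := invCmd.run I (baseCmd.run I 0) with hσ
  set B := p ^ (3 * p) with hB
  have hB0 : σ 0 = B := by rw [hσ, frame_invCmd _ (by norm_num)]; exact (run_baseCmd hp0 0).1
  have hB1 : σ 1 = B ^ p := by rw [hσ, frame_invCmd _ (by norm_num)]; exact (run_baseCmd hp0 0).2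
  -- The base `p ^ (3 * p)` is large enough because `p + 4 ≤ 3 * p` for `p ≥ 2`.
  have hBlt : p ^ (p + 3) + p ≤ B := by
    have h3 : p ≤ p ^ (p + 3) := Nat.le_self_pow (by omega) _
    calc p ^ (p + 3) + p ≤ 2 * p ^ (p + 3) := by omega
      _ ≤ p * p ^ (p + 3) := Nat.mul_le_mul_right _ h2
      _ = p ^ (p + 4) := by ring
      _ ≤ B := Nat.pow_le_pow_right (by omega) (by omega)
  have hpB : p ≤ B := by omega
  obtain ⟨hr, h3, h4⟩ := run_loadCmd hp0 hpB h2 hB0 hB1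
  set τ := loadCmd.run I σ
  set c : ℕ → ℕ := fun i => (p - I (1 + i)) * σ 13 % p with hc
  have hclt : ∀ i, c i < p := fun i => Nat.mod_lt _ (by omega)
  have hClt : ∑ i ∈ Finset.range p, c i * B ^ i < B ^ p :=
    sum_mul_pow_lt (fun i => (hclt i).trans_le hpB) p
  have hY : AdjoinRoot.root u ^ p =
      ∑ i ∈ Finset.range p, (c i : AdjoinRoot u) * AdjoinRoot.root u ^ i := by
    refine root_pow_eq hdeg (m := σ 13) ?_ ?_
    · rw [hσ, run_invCmd hp0 h2, add_comm, hI, init_dlogInput_modulus p u v w le_rfl,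
        ZMod.natCast_zmod_val]
    · intro i hi
      rw [hc, ZMod.natCast_mod, hI, init_dlogInput_modulus p u v w hi.le, Nat.cast_mul,
        Nat.cast_sub (ZMod.val_lt _).le, ZMod.natCast_zmod_val, ZMod.natCast_self, zero_sub]
  have hcode : Coding p B (B ^ p - ∑ i ∈ Finset.range p, c i * B ^ i) (AdjoinRoot.root u) :=
    { two_le := h2
      dvd := dvd_pow_self p (by omega)
      lt := hBlt
      mul := Enc.mul_mod (by omega) (fun i => Nat.le_sub_one_of_lt (hclt i)) (by omega) hY hBlt
      zero := Enc.eq_zero_iff (by omega) (by omega) (dvd_of_sum_root_pow_eq_zero hdeg) }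
  have hval : ∀ x : ZMod p, x.val ≤ p - 1 := fun x => Nat.le_sub_one_of_lt (ZMod.val_lt x)
  have hg3 : Enc p B (AdjoinRoot.root u) (p - 1) (τ 3) g := by
    refine ⟨fun i => (v.coeff i).val, fun i => hval _, ?_, ?_⟩
    · rw [h3]
      refine Finset.sum_congr rfl fun i hi => ?_
      rw [hI, init_dlogInput_base p u v w (Finset.mem_range.1 hi)]
    · rw [sum_val_mul_root_pow hv, hvg]
  have hw4 : Enc p B (AdjoinRoot.root u) (p - 1) (τ 4) (g ^ e) := by
    refine ⟨fun i => (w.coeff i).val, fun i => hval _, ?_, ?_⟩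
    · rw [h4]
      refine Finset.sum_congr rfl fun i hi => ?_
      rw [hI, init_dlogInput_target p u v w (Finset.mem_range.1 hi)]
    · rw [sum_val_mul_root_pow hw, hwg]
  have hfinal := iterate_induction (n := p) (f := digitCmd.run I) (x := divisorCmd.run I τ)
    (P := fun j (ρ : Mem) => Tracks p B _ (AdjoinRoot.root u) ρ
      ((digitStep p)^[j] (g ^ e, g ^ (p - 1) - 1, 0, 1)))
    (tracks_divisorCmd hp0 hcode hr hg3 hw4) (by
    intro j _ ρ hρ
    rw [Function.iterate_succ_apply']
    exact hρ.digitCmd hp0 hcode)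
  rw [hfinal.log]
  refine digitStep_iterate_of_digitSum_le hg ha ?_ he hs
  -- The first divisor is right: `(g ^ (p - 1) - 1) * g = g ^ p - g = a`.
  rw [sub_mul, ← pow_succ, show p - 1 + 1 = p by omega, hg]
  ring

end AdjoinRoot

end RAM

/-! ### The main theorem. -/

theorem mainTheorem4 :
    ∃ (A : RAM.Prog) (P : ℝ[X]),
      ∀ (p : ℕ) [Fact p.Prime] (u : (ZMod p)[X]) [Fact (Irreducible u)],
        u.natDegree = p →
        ∀ (α : AdjoinRoot u) (a b : ZMod p),
          (ZMod p)⟮α⟯ = ⊤ →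
          a ≠ 0 →
          α ^ p - α = algebraMap (ZMod p) (AdjoinRoot u) a →
          ∀ g : AdjoinRoot u, g = α + algebraMap (ZMod p) (AdjoinRoot u) b →
            ∀ e : ℕ, e < p ^ p → digitSum p e ≤ p - 1 →
              (∀ v w : (ZMod p)[X], v.natDegree < p → w.natDegree < p →
                AdjoinRoot.mk u v = g → AdjoinRoot.mk u w = g ^ e →
                RAM.OutputsWithin A (dlogInput p u v w) e
                  (P.eval (Real.log ((p : ℝ) ^ p)))) ∧
              ¬ ∃ e' : ℕ, e' ≠ e ∧ e' < p ^ p ∧ digitSum p e' ≤ p - 1 ∧ g ^ e' = g ^ e := by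
  obtain ⟨K, m, hK⟩ := RAM.dlogCmd.exists_outputsWithin 11
  -- The bound `K * p ^ m` becomes a polynomial in `log (p ^ p) = p log p` through `log p ≥ 1 / 2`,
  -- whence `p ≤ 2 log (p ^ p)`.
  refine ⟨RAM.dlogCmd.toProgram 11, Polynomial.C (K : ℝ) * (Polynomial.C 2 * Polynomial.X) ^ m, ?_⟩
  intro p hp u hu hdeg α a b _ ha hα g hgα e he hs
  have h2 := hp.out.two_le
  have hg : g ^ p = g + algebraMap (ZMod p) (AdjoinRoot u) a := by
    have : CharP (AdjoinRoot u) p :=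
      charP_of_injective_algebraMap (algebraMap (ZMod p) (AdjoinRoot u)).injective p
    rw [hgα, add_pow_char, ← map_pow, ZMod.pow_card]
    linear_combination hα
  refine ⟨fun v w hv hw hvg hwg => ?_, ?_⟩
  · obtain ⟨M, t, hE, hM, ht⟩ := hK (dlogInput p u v w) p h2 (RAM.length_dlogInput p u v w) rfl
      (fun x hx => RAM.le_of_mem_dlogInput p u v w hx)
      (RAM.tame_dlogCmd h2 fun i => by
        rw [RAM.init_dlogInput_zero]
        unfold RAM.init
        rcases lt_or_ge i (dlogInput p u v w).length with hi | hi
        · rw [List.getD_eq_getElem _ _ hi]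
          exact RAM.le_of_mem_dlogInput p u v w (List.getElem_mem hi)
        · rw [List.getD_eq_default _ _ hi]
          exact Nat.zero_le _)
    refine ⟨M, t, hE, hM.trans (RAM.run_dlogCmd hdeg ha hg hv hw he hs hvg hwg), ht.trans ?_⟩
    have hp2 : (2 : ℝ) ≤ p := by exact_mod_cast h2
    have hlog : (1 : ℝ) / 2 ≤ Real.log p := by
      have h3 := Real.log_two_gt_d9
      have h4 := Real.log_le_log (by norm_num) hp2
      linarith
    have hle : (p : ℝ) ≤ 2 * Real.log ((p : ℝ) ^ p) := by
      rw [Real.log_pow]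
      nlinarith
    simp only [Polynomial.eval_mul, Polynomial.eval_pow, Polynomial.eval_C, Polynomial.eval_X]
    push_cast
    gcongr
  -- Both exponents have the same input `(v, w)`, and the program's single result on it equals each
  -- of them.
  · rintro ⟨e', hne, he', hs', heq⟩
    have hrep : ∀ x : AdjoinRoot u, ∃ v : (ZMod p)[X], v.natDegree < p ∧ AdjoinRoot.mk u v = x := by
      intro x
      obtain ⟨v, rfl⟩ := AdjoinRoot.mk_surjective x
      refine ⟨v % u, ?_, ?_⟩
      · exact (Polynomial.natDegree_mod_lt v (by omega)).trans_eq hdeg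
      · rw [AdjoinRoot.mk_eq_mk]
        exact ⟨-(v / u), by
          have := EuclideanDomain.div_add_mod v u
          linear_combination this⟩
    obtain ⟨v, hv, hvg⟩ := hrep g
    obtain ⟨w, hw, hwg⟩ := hrep (g ^ e)
    exact hne ((RAM.run_dlogCmd hdeg ha hg hv hw he' hs' hvg (hwg.trans heq.symm)).symm.trans
      (RAM.run_dlogCmd hdeg ha hg hv hw he hs hvg hwg))
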